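/- Let $c_0,c_1,c_2,\Omega,\gamma,\gamma_r\in\mathbb{R}$ and consider, for $\Psi=(\psi_2,\psi_1,\psi_0,\psi_{-1},\psi_{-2})^\top:[0,\infty)\times\mathbb{R}^2\to\mathbb{C}^5$, the two-dimensional coupled Gross--Pitaevskii equations of a rotating spin-orbit coupled spin-2 Bose--Einstein condensate in a radially symmetric harmonic trap, $$i\partial_t\Psi=\Big(-\tfrac12\Delta+\tfrac{\gamma_r^2}{2}(x^2+y^2)+c_0\rho-\Omega L_z\Big)\Psi+c_1(F_xf_x+F_yf_y+F_zf_z)\Psi-\gamma\,\mathcal{S}\Psi+c_2A_{00}A\bar\Psi .$$ Here $\rho=\sum_{\ell=-2}^{2}|\psi_\ell|^2$, $L_z=-i(x\partial_y-y\partial_x)$, $L_\pm=i\partial_y\pm\partial_x$. Let $R$ be the real $5\times5$ matrix with superdiagonal $(1,\frac{\sqrt6}{2},\frac{\sqrt6}{2},1)$ and zeros elsewhere; then $f_x=R+R^\top$, $f_y=i(R^\top-R)$, $f_z=\mathrm{diag}(2,1,0,-1,-2)$ are the spin-2 matrices, $F_\alpha=\Psi^{\mathsf H}f_\alpha\Psi$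 for $\alpha=x,y,z$, $F_+=F_x+iF_y$, and $\mathcal{S}=L_-R+L_+R^\top$. Finally $A_{jk}=\frac{1}{\sqrt5}(-1)^{j-1}\delta_{j+k,6}$ for $1\le j,k\le5$, and $A_{00}=\Psi^\top A\Psi$. Let $\Psi$ be a smooth solution for $t\ge0$ all of whose spatial derivatives (including $\Psi$ itself) decay faster than any power of $|\mathbf{x}|$, uniformly on bounded time intervals. For $t\ge 0$ put $$\delta_x(t)=\sum_{\ell}\int_{\mathbb{R}^2}x^2|\psi_\ell|^2\,d\mathbf{x},\quad \delta_y(t)=\sum_{\ell}\int_{\mathbb{R}^2}y^2|\psi_\ell|^2\,d\mathbf{x},\quad \delta_r=\delta_x+\delta_y,\quad \sigma_x=\sqrt{\delta_x},\ \sigma_y=\sqrt{\delta_y},\quad \langle L_z\rangle(t)=\sum_\ell\int_{\mathbb{R}^2}\bar\psi_\ell L_z\psi_\ell\,d\mathbf{x},$$ $$\mathcal{E}(t)=\int_{\mathbb{R}^2}\sum_\ell\Big(\tfrac12|\nabla\psi_\ell|^2+\tfrac{\gamma_r^2}{2}(x^2+y^2)|\psi_\ell|^2-\Omega\bar\psi_\ell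 L_z\psi_\ell\Big)+\tfrac{c_0}{2}\rho^2+\tfrac{c_1}{2}\big(|F_+|^2+|F_z|^2\big)+\tfrac{c_2}{2}|A_{00}|^2-\gamma\,\Psi^{\mathsf H}\mathcal{S}\Psi\,d\mathbf{x}.$$ All these integrals converge, $\mathcal{E}$ and $\langle L_z\rangle$ are real, $\delta_x$ and $\delta_y$ are differentiable, $\delta_r$ is twice differentiable, and for all $t\ge0$ (derivatives at $t=0$ being one-sided) $$\frac{d^2\delta_r(t)}{dt^2}=-4\gamma_r^2\delta_r(t)+4\mathcal{E}(0)+4\Omega\langle L_z\rangle(t)+G(\gamma,\Psi(\cdot,t)),$$ where the convergent integral $G$ is given by $$G(\gamma,\Psi)=2\gamma\,\Re\int_{\mathbb{R}^2}\Big[\Omega(iy-x)F_++\gamma\Big(2\rho+3|\psi_1|^2+4|\psi_0|^2+3|\psi_{-1}|^2+\sum_{\ell=-2}^{2}\ell\,\bar\psi_\ell L_z\psi_\ell\Big)\Big]d\mathbf{x}.$$ If moreover $\gamma=0$ and $\gamma_r>0$, then for all $t\ge0$ $$\delta_r(t)=\frac{\mathcal{E}(0)+\Omega\langle L_z\rangle(0)}{\gamma_r^2}\big[1-\cos(2\gamma_rt)\big]+\delta_r^{(0)}\cos(2\gamma_rt)+\frac{\delta_r^{(1)}}{2\gamma_r}\sin(2\gamma_rt),$$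 with $\delta_r^{(0)}=\delta_x(0)+\delta_y(0)$ and $\delta_r^{(1)}=\dot\delta_x(0)+\dot\delta_y(0)$; in particular $\delta_r$ is periodic with angular frequency $2\gamma_r$, that is, $\delta_r(t+\frac{2\pi}{2\gamma_r})=\delta_r(t)$ for $t\ge0$. If in addition $\Psi(\cdot,0)$ is radially symmetric (depends only on $|\mathbf{x}|$), then $\delta_x(t)=\delta_y(t)=\frac12\delta_r(t)$ for all $t\ge0$, and the condensate widths $\sigma_x,\sigma_y$ are periodic with angular frequency $2\gamma_r$ (period $\frac{2\pi}{2\gamma_r}$). -/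

import Mathlib

open scoped ContDiff Matrix
open MeasureTheory

namespace SpinTwoBEC

noncomputable section

/-- The plane `ℝ²` with the Euclidean norm and Lebesgue measure; `p 0 = x`, `p 1 = y`. -/
abbrev Plane : Type := EuclideanSpace ℝ (Fin 2)

/-- A spin-2 spinor. The entries `0, 1, 2, 3, 4` are `ψ₂, ψ₁, ψ₀, ψ₋₁, ψ₋₂`, in this order. -/
abbrev Spinor : Type := Fin 5 → ℂ

/-- The real parameters of the coupled Gross-Pitaevskii equations: interaction constants
`c₀, c₁, c₂`, angular velocity `Ω`, spin-orbit coupling strength `γ`, and the trap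
frequencies `γx, γy`. -/
structure Params where
  c₀ : ℝ
  c₁ : ℝ
  c₂ : ℝ
  Ω : ℝ
  γ : ℝ
  γx : ℝ
  γy : ℝ

/-! ### Differential operators -/

/-- `∂ₓ f`. -/
def dX (f : Plane → ℂ) (p : Plane) : ℂ := fderiv ℝ f p (EuclideanSpace.single 0 1)

/-- `∂_y f`. -/
def dY (f : Plane → ℂ) (p : Plane) : ℂ := fderiv ℝ f p (EuclideanSpace.single 1 1)

/-- Angular momentum `L_z = -i (x ∂_y - y ∂ₓ)`. -/
def Lz (f : Plane → ℂ) (p : Plane) : ℂ :=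
  -Complex.I * ((p 0 : ℂ) * dY f p - (p 1 : ℂ) * dX f p)

/-- `L₊ = i ∂_y + ∂ₓ`. -/
def Lplus (f : Plane → ℂ) (p : Plane) : ℂ := Complex.I * dY f p + dX f p

/-- `L₋ = i ∂_y - ∂ₓ`. -/
def Lminus (f : Plane → ℂ) (p : Plane) : ℂ := Complex.I * dY f p - dX f p

/-! ### Spin matrices and pointwise spinor quantities -/

/-- The number `√6 / 2`. -/
def halfSqrt6 : ℂ := ((Real.sqrt 6 / 2 : ℝ) : ℂ)

/-- The spin-2 matrix `f_x`. -/
def fx : Matrix (Fin 5) (Fin 5) ℂ :=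
  !![0, 1, 0, 0, 0;
     1, 0, halfSqrt6, 0, 0;
     0, halfSqrt6, 0, halfSqrt6, 0;
     0, 0, halfSqrt6, 0, 1;
     0, 0, 0, 1, 0]

/-- The spin-2 matrix `f_y`. -/
def fy : Matrix (Fin 5) (Fin 5) ℂ :=
  Complex.I • !![0, -1, 0, 0, 0;
                 1, 0, -halfSqrt6, 0, 0;
                 0, halfSqrt6, 0, -halfSqrt6, 0;
                 0, 0, halfSqrt6, 0, -1;
                 0, 0, 0, 1, 0]

/-- The spin-2 matrix `f_z`. -/
def fz : Matrix (Fin 5) (Fin 5) ℂ :=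
  !![2, 0, 0, 0, 0;
     0, 1, 0, 0, 0;
     0, 0, 0, 0, 0;
     0, 0, 0, -1, 0;
     0, 0, 0, 0, -2]

/-- The matrix `A` of the singlet pairing term. -/
def A : Matrix (Fin 5) (Fin 5) ℂ :=
  ((1 / Real.sqrt 5 : ℝ) : ℂ) •
    !![0, 0, 0, 0, 1;
       0, 0, 0, -1, 0;
       0, 0, 1, 0, 0;
       0, -1, 0, 0, 0;
       1, 0, 0, 0, 0]

/-- `F_x = Ψᴴ f_x Ψ`, a component of the spin vector. -/
def Fx (v : Spinor) : ℂ := star v ⬝ᵥ (fx *ᵥ v)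

/-- `F_y = Ψᴴ f_y Ψ`. -/
def Fy (v : Spinor) : ℂ := star v ⬝ᵥ (fy *ᵥ v)

/-- `F_z = Ψᴴ f_z Ψ`. -/
def Fz (v : Spinor) : ℂ := star v ⬝ᵥ (fz *ᵥ v)

/-- `F₊ = F_x + i F_y`. -/
def Fplus (v : Spinor) : ℂ := Fx v + Complex.I * Fy v

/-- `A₀₀ = Ψᵀ A Ψ`. -/
def A00 (v : Spinor) : ℂ := v ⬝ᵥ (A *ᵥ v)

/-- The total density `ρ = ∑ |ψ_ℓ|²`. -/
def rho (v : Spinor) : ℝ := ∑ l, ‖v l‖ ^ 2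

/-- The matrix `F · f`. -/
def Fdotf (v : Spinor) : Matrix (Fin 5) (Fin 5) ℂ := Fx v • fx + Fy v • fy + Fz v • fz

/-! ### The equations -/

/-- The harmonic potential `V = (γx² x² + γy² y²) / 2`. -/
def Params.V (P : Params) (p : Plane) : ℝ := (P.γx ^ 2 * p 0 ^ 2 + P.γy ^ 2 * p 1 ^ 2) / 2

/-- The `l`-th component of a spinor field. -/
def comp (Φ : Plane → Spinor) (l : Fin 5) (p : Plane) : ℂ := Φ p l

/-- The spin-orbit term `𝒮 Φ`. -/
def soc (Φ : Plane → Spinor) (p : Plane) : Spinor :=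
  ![Lminus (comp Φ 1) p,
    Lplus (comp Φ 0) p + halfSqrt6 * Lminus (comp Φ 2) p,
    halfSqrt6 * Lplus (comp Φ 1) p + halfSqrt6 * Lminus (comp Φ 3) p,
    halfSqrt6 * Lplus (comp Φ 2) p + Lminus (comp Φ 4) p,
    Lplus (comp Φ 3) p]

/-- `ℋ₀ φ = (-Δ/2 + V + c₀ ρ - Ω L_z) φ` for the `l`-th component `φ` of `Φ`. -/
def Params.H0 (P : Params) (Φ : Plane → Spinor) (l : Fin 5) (p : Plane) : ℂ :=
  -(1 / 2) * Laplacian.laplacian (comp Φ l) p + (P.V p : ℂ) * Φ p l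
    + (P.c₀ : ℂ) * (rho (Φ p) : ℂ) * Φ p l - (P.Ω : ℂ) * Lz (comp Φ l) p

/-- The right-hand side
`(ℋ₀ I₅ + c₁ F·f - γ 𝒮) Φ + c₂ A₀₀ A Φ̄` of the coupled Gross-Pitaevskii equations. -/
def Params.rhs (P : Params) (Φ : Plane → Spinor) (l : Fin 5) (p : Plane) : ℂ :=
  P.H0 Φ l p + (P.c₁ : ℂ) * (Fdotf (Φ p) *ᵥ Φ p) l - (P.γ : ℂ) * soc Φ p l
    + (P.c₂ : ℂ) * A00 (Φ p) * (A *ᵥ star (Φ p)) l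

/-- `Ψ` (time first, then space) is a smooth solution for `t ≥ 0` of the coupled
Gross-Pitaevskii equations which, with all its space derivatives, decays faster than every power
of `|𝐱|`, uniformly on bounded time intervals. The time derivative at `t = 0` is one-sided. -/
structure Params.IsSolution (P : Params) (Ψ : ℝ → Plane → Spinor) : Prop where
  smooth : ContDiffOn ℝ ∞ (fun q : ℝ × Plane => Ψ q.1 q.2) (Set.Ici 0 ×ˢ Set.univ)
  decay : ∀ T : ℝ, ∀ k n : ℕ, ∃ C : ℝ, ∀ t ∈ Set.Icc 0 T, ∀ p : Plane,
    ‖p‖ ^ k * ‖iteratedFDeriv ℝ n (Ψ t) p‖ ≤ C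
  eqn : ∀ t : ℝ, 0 ≤ t → ∀ (p : Plane) (l : Fin 5),
    Complex.I * derivWithin (fun τ => Ψ τ p l) (Set.Ici 0) t = P.rhs (Ψ t) l p

/-- Radial symmetry: the value depends on `|𝐱|` only. -/
def IsRadial (Φ : Plane → Spinor) : Prop := ∀ p q : Plane, ‖p‖ = ‖q‖ → Φ p = Φ q

/-! ### Physical quantities of a spinor field at a fixed time -/

/-- The energy density. Its integral is real although the density is complex-valued. -/
def Params.energyDensity (P : Params) (Φ : Plane → Spinor) (p : Plane) : ℂ :=
  (∑ l, (((‖dX (comp Φ l) p‖ ^ 2 + ‖dY (comp Φ l) p‖ ^ 2) / 2 + P.V p * ‖Φ p l‖ ^ 2 : ℝ) : ℂ))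
    - (P.Ω : ℂ) * ∑ l, star (Φ p l) * Lz (comp Φ l) p
    + ((P.c₀ / 2 * rho (Φ p) ^ 2 + P.c₁ / 2 * (‖Fplus (Φ p)‖ ^ 2 + ‖Fz (Φ p)‖ ^ 2)
        + P.c₂ / 2 * ‖A00 (Φ p)‖ ^ 2 : ℝ) : ℂ)
    - (P.γ : ℂ) * ∑ l, star (Φ p l) * soc Φ p l

/-- The energy `ℰ(Φ)`. -/
def Params.energy (P : Params) (Φ : Plane → Spinor) : ℂ := ∫ p, P.energyDensity Φ p

/-- The density of the angular momentum expectation. -/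
def angMomDensity (Φ : Plane → Spinor) (p : Plane) : ℂ := ∑ l, star (Φ p l) * Lz (comp Φ l) p

/-- The angular momentum expectation `⟨L_z⟩`. -/
def angMom (Φ : Plane → Spinor) : ℂ := ∫ p, angMomDensity Φ p

/-- `δ_x` for `a = 0` and `δ_y` for `a = 1`. -/
def delta (a : Fin 2) (Φ : Plane → Spinor) : ℝ := ∑ l, ∫ p, p a ^ 2 * ‖Φ p l‖ ^ 2

/-- `δ_r = δ_x + δ_y`. -/
def deltaR (Φ : Plane → Spinor) : ℝ := delta 0 Φ + delta 1 Φ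

/-- The condensate widths `σ_x` (`a = 0`) and `σ_y` (`a = 1`). -/
def sigma (a : Fin 2) (Φ : Plane → Spinor) : ℝ := Real.sqrt (delta a Φ)

/-- The integrand of `G(γ, Φ)`. -/
def Params.gDensity (P : Params) (Φ : Plane → Spinor) (p : Plane) : ℂ :=
  (P.Ω : ℂ) * (Complex.I * (p 1 : ℂ) - (p 0 : ℂ)) * Fplus (Φ p)
    + (P.γ : ℂ) *
      (((2 * rho (Φ p) + 3 * ‖Φ p 1‖ ^ 2 + 4 * ‖Φ p 2‖ ^ 2 + 3 * ‖Φ p 3‖ ^ 2 : ℝ) : ℂ)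
        + 2 * (star (Φ p 0) * Lz (comp Φ 0) p) + star (Φ p 1) * Lz (comp Φ 1) p
        - star (Φ p 3) * Lz (comp Φ 3) p - 2 * (star (Φ p 4) * Lz (comp Φ 4) p))

/-- `G(γ, Φ)`. -/
def Params.G (P : Params) (Φ : Plane → Spinor) : ℝ := 2 * P.γ * (∫ p, P.gDensity Φ p).re

end

end SpinTwoBEC

/-! Write the equations as `i∂ₜu = Hu + N(u)` with the symmetric operator `H = T + (γr²/2)r² - ΩL_z
+ γK`, where `T = -Δ/2` and `K = -𝒮 = -i(f_x∂_y - f_y∂ₓ)`, and with `N` the gradient of a real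
quartic energy density `W`. For a symmetric operator `O`, Ehrenfest's theorem
(`Params.Evolves.weakDeriv`) says that `⟨O⟩` has derivative `⟨i[H,O]⟩ + ∫ dW(u)[iOu]`. All
integrations by parts are recorded by `EqDiv`, equality up to the divergence of a rapidly decreasing
field.

Put `D = -i(x·∇ + 1)` and `M = y f_x - x f_y`. Taking `O = r²` gives `δ_r' = 2⟨D⟩ + 2γ⟨M⟩`; `W`
contributes nothing because it is blind to phases. Dilation scales `T`, `r²`, `L_z` and `K` with
degrees `-2`, `2`, `0` and `-1`, and a quartic density in two dimensions contributes `2W`, so `⟨D⟩'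
= 2⟨T⟩ - γr²δ_r + γ⟨K⟩ + 2∫W`. Since `W` is invariant under local spin rotations, `⟨M⟩'` comes from
commutators alone: `⟨K⟩ - Ω⟨x f_x + y f_y⟩ + γ⟨f_x² + f_y² + L_z f_z⟩`. In `2⟨D⟩' + 2γ⟨M⟩'` the two
shares of `⟨K⟩` add up to `4γ⟨K⟩`, which is what `4ℰ` requires, and the remaining terms are
`-4γr²δ_r + 4Ω⟨L_z⟩ + G`. Conservation of `ℰ` is the case `O = H` together with the derivative of
`∫W`.

If `γ = 0`, then `G = 0`, and `L_z` commutes with `H` and preserves `∫W`. Hence `δ_r` is a harmonic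
oscillator of frequency `2γr` under a constant force, solved in `harmonic_oscillator`.

For radial data the rotated solution solves the same equations, and a Grönwall estimate for the `L²`
norm of the difference (`total_dens_sub_turn_eq_zero`) shows that the symmetry persists. A quarter
turn is enough, because it already exchanges `x²` and `y²`.

Times are indexed by `ℝ≥0`, so only values at `t ≥ 0` enter and derivatives at `0` are one-sided.
`Nice` is the class of slicewise smooth families with Schwartz bounds uniform on bounded time
intervals; closed under all operations used, it justifies every integral and every differentiation
under the integral sign. -/

namespace SpinTwoBEC

open Filter Topology
open scoped NNReal

noncomputable section

/-! ### Time-dependent families of rapidly decreasing functions -/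

/-- Complex functions on the plane depending on a time `t ≥ 0`. -/
abbrev Family : Type := ℝ≥0 → Plane → ℂ

/-- The partial derivative in the direction of the `a`-th coordinate, time by time. -/
def pd (a : Fin 2) (f : Family) : Family :=
  fun t p => fderiv ℝ (f t) p (EuclideanSpace.single a 1)

/-- The `a`-th coordinate function. -/
def coord (a : Fin 2) : Family := fun _ p => ((p a : ℝ) : ℂ)

/-- A constant function. -/
def cst (c : ℂ) : Family := fun _ _ => c

/-- Every time slice is smooth. -/
def SliceSmooth (f : Family) : Prop := ∀ t, ContDiff ℝ ∞ (f t)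

/-- Decay faster than every power, uniformly on bounded time intervals. -/
def RapidDecay (f : Family) : Prop :=
  ∀ T : ℝ≥0, ∀ k : ℕ, ∃ C : ℝ, ∀ t ≤ T, ∀ p : Plane, ‖p‖ ^ k * ‖f t p‖ ≤ C

/-- Rapid decay of all partial derivatives of order at most `n`. -/
def RapidDecayOrder : ℕ → Family → Prop
  | 0, f => RapidDecay f
  | n + 1, f => RapidDecay f ∧ ∀ a, RapidDecayOrder n (pd a f)

/-- Families of Schwartz functions, uniformly on bounded time intervals. -/
structure Nice (f : Family) : Prop where
  smooth : SliceSmooth f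
  decay : ∀ n, RapidDecayOrder n f

@[simp] lemma cst_apply (c : ℂ) (t : ℝ≥0) (p : Plane) : cst c t p = c := rfl
@[simp] lemma coord_apply (a : Fin 2) (t : ℝ≥0) (p : Plane) :
    coord a t p = ((p a : ℝ) : ℂ) := rfl

lemma SliceSmooth.differentiableAt {f : Family} (hf : SliceSmooth f) (t : ℝ≥0) (p : Plane) :
    DifferentiableAt ℝ (f t) p := (hf t).differentiable (by simp) p

@[simp] lemma SliceSmooth.add {f g : Family} (hf : SliceSmooth f) (hg : SliceSmooth g) :
    SliceSmooth (f + g) := fun t => (hf t).add (hg t)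

@[simp] lemma SliceSmooth.sub {f g : Family} (hf : SliceSmooth f) (hg : SliceSmooth g) :
    SliceSmooth (f - g) := fun t => (hf t).sub (hg t)

@[simp] lemma SliceSmooth.mul {f g : Family} (hf : SliceSmooth f) (hg : SliceSmooth g) :
    SliceSmooth (f * g) := fun t => (hf t).mul (hg t)

@[simp] lemma SliceSmooth.star {f : Family} (hf : SliceSmooth f) : SliceSmooth (star f) :=
  fun t => Complex.conjCLE.contDiff.comp (hf t)

@[simp] lemma sliceSmooth_cst (c : ℂ) : SliceSmooth (cst c) := fun _ => contDiff_const

@[simp] lemma sliceSmooth_coord (a : Fin 2) : SliceSmooth (coord a) := fun _ =>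
  Complex.ofRealCLM.contDiff.comp (EuclideanSpace.proj (𝕜 := ℝ) a).contDiff

@[simp] lemma SliceSmooth.pd {f : Family} (hf : SliceSmooth f) (a : Fin 2) : SliceSmooth (pd a f) :=
  fun t => ((hf t).fderiv_right (m := ∞) (by simp)).clm_apply contDiff_const

@[simp] lemma pd_add {f g : Family} (hf : SliceSmooth f) (hg : SliceSmooth g) (a : Fin 2) :
    pd a (f + g) = pd a f + pd a g := by
  funext t p
  simp only [pd, Pi.add_apply]
  rw [fderiv_add (hf.differentiableAt t p) (hg.differentiableAt t p)]
  rfl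

@[simp] lemma pd_neg (f : Family) (a : Fin 2) : pd a (-f) = -pd a f := by
  funext t p
  simp only [pd, Pi.neg_apply]
  rw [fderiv_neg]
  rfl

@[simp] lemma pd_sub {f g : Family} (hf : SliceSmooth f) (hg : SliceSmooth g) (a : Fin 2) :
    pd a (f - g) = pd a f - pd a g := by
  funext t p
  simp only [pd, Pi.sub_apply]
  rw [fderiv_sub (hf.differentiableAt t p) (hg.differentiableAt t p)]
  rfl

@[simp] lemma pd_mul {f g : Family} (hf : SliceSmooth f) (hg : SliceSmooth g) (a : Fin 2) :
    pd a (f * g) = pd a f * g + f * pd a g := by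
  funext t p
  simp only [pd, Pi.mul_apply, Pi.add_apply]
  rw [fderiv_mul (hf.differentiableAt t p) (hg.differentiableAt t p)]
  simp [mul_comm, add_comm]

@[simp] lemma pd_star {f : Family} (hf : SliceSmooth f) (a : Fin 2) :
    pd a (star f) = star (pd a f) := by
  funext t p
  have h : HasFDerivAt (fun q => Complex.conjCLE (f t q))
      ((Complex.conjCLE : ℂ →L[ℝ] ℂ).comp (fderiv ℝ (f t) p)) p :=
    (Complex.conjCLE : ℂ →L[ℝ] ℂ).hasFDerivAt.comp p (hf.differentiableAt t p).hasFDerivAt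
  change fderiv ℝ (fun q => Complex.conjCLE (f t q)) p _ = _
  rw [h.fderiv]
  rfl

@[simp] lemma pd_cst (c : ℂ) (a : Fin 2) : pd a (cst c) = 0 := by
  funext t p
  have : cst c t = fun _ => c := rfl
  simp [pd, this]

lemma pd_coord (a b : Fin 2) : pd a (coord b) = cst (if a = b then 1 else 0) := by
  funext t p
  have h : HasFDerivAt (fun q : Plane => ((q b : ℝ) : ℂ))
      (Complex.ofRealCLM.comp (EuclideanSpace.proj (𝕜 := ℝ) b : Plane →L[ℝ] ℝ)) p :=
    Complex.ofRealCLM.hasFDerivAt.comp p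
      (EuclideanSpace.proj (𝕜 := ℝ) b : Plane →L[ℝ] ℝ).hasFDerivAt
  change fderiv ℝ (fun q : Plane => ((q b : ℝ) : ℂ)) p _ = _
  rw [h.fderiv]
  by_cases hab : a = b
  · simp [hab]
  · simp [hab, Ne.symm hab]

lemma pd_comm {f : Family} (hf : SliceSmooth f) (a b : Fin 2) :
    pd a (pd b f) = pd b (pd a f) := by
  have key : ∀ a b t p, pd a (pd b f) t p =
      fderiv ℝ (fderiv ℝ (f t)) p (EuclideanSpace.single a 1) (EuclideanSpace.single b 1) := by
    intro a b t p
    have hd : DifferentiableAt ℝ (fderiv ℝ (f t)) p :=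
      ((hf t).fderiv_right (m := ∞) (by simp)).differentiable (by simp) p
    change fderiv ℝ (fun q => fderiv ℝ (f t) q (EuclideanSpace.single b 1)) p _ = _
    rw [fderiv_clm_apply hd (differentiableAt_const _)]
    simp
  funext t p
  rw [key, key]
  have : IsSymmSndFDerivAt ℝ (f t) p :=
    (contDiff_infty.1 (hf t) 2).contDiffAt.isSymmSndFDerivAt (by simp)
  exact this.eq _ _

lemma RapidDecay.add {f g : Family} (hf : RapidDecay f) (hg : RapidDecay g) :
    RapidDecay (f + g) := by
  intro T k
  obtain ⟨C, hC⟩ := hf T k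
  obtain ⟨D, hD⟩ := hg T k
  refine ⟨C + D, fun t ht p => ?_⟩
  calc ‖p‖ ^ k * ‖(f + g) t p‖ ≤ ‖p‖ ^ k * (‖f t p‖ + ‖g t p‖) := by
        gcongr; exact norm_add_le _ _
    _ ≤ C + D := by rw [mul_add]; exact add_le_add (hC t ht p) (hD t ht p)

lemma RapidDecay.mul {f g : Family} (hf : RapidDecay f) (hg : RapidDecay g) :
    RapidDecay (f * g) := by
  intro T k
  obtain ⟨C, hC⟩ := hf T k
  obtain ⟨D, hD⟩ := hg T 0
  refine ⟨C * D, fun t ht p => ?_⟩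
  have h2 := hD t ht p
  simp only [pow_zero, one_mul] at h2
  calc ‖p‖ ^ k * ‖(f * g) t p‖ = (‖p‖ ^ k * ‖f t p‖) * ‖g t p‖ := by
        simp [mul_assoc]
    _ ≤ C * D := mul_le_mul (hC t ht p) h2 (norm_nonneg _)
        (le_trans (by positivity) (hC t ht p))

lemma RapidDecay.star {f : Family} (hf : RapidDecay f) : RapidDecay (star f) := by
  intro T k
  obtain ⟨C, hC⟩ := hf T k
  exact ⟨C, fun t ht p => by simpa using hC t ht p⟩

lemma RapidDecay.cst_mul {f : Family} (hf : RapidDecay f) (c : ℂ) : RapidDecay (cst c * f) := by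
  intro T k
  obtain ⟨C, hC⟩ := hf T k
  refine ⟨‖c‖ * C, fun t ht p => ?_⟩
  calc ‖p‖ ^ k * ‖(cst c * f) t p‖ = ‖c‖ * (‖p‖ ^ k * ‖f t p‖) := by simp; ring
    _ ≤ _ := by gcongr; exact hC t ht p

lemma RapidDecay.coord_mul {f : Family} (hf : RapidDecay f) (a : Fin 2) :
    RapidDecay (coord a * f) := by
  intro T k
  -- The coordinate factor costs one power of the norm.
  obtain ⟨C, hC⟩ := hf T (k + 1)
  refine ⟨C, fun t ht p => le_trans ?_ (hC t ht p)⟩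
  have : ‖p a‖ ≤ ‖p‖ := PiLp.norm_apply_le p a
  calc ‖p‖ ^ k * ‖(coord a * f) t p‖ = ‖p‖ ^ k * (‖p a‖ * ‖f t p‖) := by simp
    _ ≤ ‖p‖ ^ k * (‖p‖ * ‖f t p‖) := by gcongr
    _ = _ := by ring

lemma RapidDecayOrder.add : ∀ {n : ℕ} {f g : Family}, SliceSmooth f → SliceSmooth g →
    RapidDecayOrder n f → RapidDecayOrder n g → RapidDecayOrder n (f + g)
  | 0, _, _, _, _, h1, h2 => RapidDecay.add h1 h2
  | n + 1, _, _, hf, hg, h1, h2 => ⟨h1.1.add h2.1, fun a => by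
      rw [pd_add hf hg]
      exact (h1.2 a).add (hf.pd a) (hg.pd a) (h2.2 a)⟩

lemma RapidDecayOrder.of_succ : ∀ {n : ℕ} {f : Family},
    RapidDecayOrder (n + 1) f → RapidDecayOrder n f
  | 0, _, h => h.1
  | _ + 1, _, h => ⟨h.1, fun a => (h.2 a).of_succ⟩

/-- By the Leibniz rule each term of a derivative has one differentiated factor; the
undifferentiated one is weakened by one order so that the induction hypothesis applies to both. -/
lemma RapidDecayOrder.mul : ∀ {n : ℕ} {f g : Family}, SliceSmooth f → SliceSmooth g →
    RapidDecayOrder n f → RapidDecayOrder n g → RapidDecayOrder n (f * g)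
  | 0, _, _, _, _, h1, h2 => RapidDecay.mul h1 h2
  | n + 1, _, _, hf, hg, h1, h2 => ⟨h1.1.mul h2.1, fun a => by
      rw [pd_mul hf hg]
      exact ((h1.2 a).mul (hf.pd a) hg h2.of_succ).add ((hf.pd a).mul hg) (hf.mul (hg.pd a))
        (h1.of_succ.mul hf (hg.pd a) (h2.2 a))⟩

lemma RapidDecayOrder.star : ∀ {n : ℕ} {f : Family}, SliceSmooth f →
    RapidDecayOrder n f → RapidDecayOrder n (star f)
  | 0, _, _, h => RapidDecay.star h
  | n + 1, _, hf, h => ⟨h.1.star, fun a => by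
      rw [pd_star hf]; exact (h.2 a).star (hf.pd a)⟩

lemma RapidDecayOrder.cst_mul : ∀ {n : ℕ} {f : Family}, SliceSmooth f → (c : ℂ) →
    RapidDecayOrder n f → RapidDecayOrder n (cst c * f)
  | 0, _, _, c, h => RapidDecay.cst_mul h c
  | n + 1, _, hf, c, h => ⟨h.1.cst_mul c, fun a => by
      rw [pd_mul (sliceSmooth_cst c) hf, pd_cst, zero_mul, zero_add]
      exact (h.2 a).cst_mul (hf.pd a) c⟩

lemma RapidDecayOrder.coord_mul : ∀ {n : ℕ} {f : Family}, SliceSmooth f → (b : Fin 2) →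
    RapidDecayOrder n f → RapidDecayOrder n (coord b * f)
  | 0, _, _, b, h => RapidDecay.coord_mul h b
  | n + 1, _, hf, b, h => ⟨h.1.coord_mul b, fun a => by
      rw [pd_mul (sliceSmooth_coord b) hf, pd_coord]
      exact (h.of_succ.cst_mul hf _).add ((sliceSmooth_cst _).mul hf)
        ((sliceSmooth_coord b).mul (hf.pd a)) ((h.2 a).coord_mul (hf.pd a) b)⟩

namespace Nice

lemma add {f g : Family} (hf : Nice f) (hg : Nice g) : Nice (f + g) :=
  ⟨hf.1.add hg.1, fun n => (hf.2 n).add hf.1 hg.1 (hg.2 n)⟩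

lemma mul {f g : Family} (hf : Nice f) (hg : Nice g) : Nice (f * g) :=
  ⟨hf.1.mul hg.1, fun n => (hf.2 n).mul hf.1 hg.1 (hg.2 n)⟩

lemma star {f : Family} (hf : Nice f) : Nice (star f) :=
  ⟨hf.1.star, fun n => (hf.2 n).star hf.1⟩

lemma cst_mul {f : Family} (hf : Nice f) (c : ℂ) : Nice (cst c * f) :=
  ⟨(sliceSmooth_cst c).mul hf.1, fun n => (hf.2 n).cst_mul hf.1 c⟩

lemma coord_mul {f : Family} (hf : Nice f) (b : Fin 2) : Nice (coord b * f) :=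
  ⟨(sliceSmooth_coord b).mul hf.1, fun n => (hf.2 n).coord_mul hf.1 b⟩

lemma pd {f : Family} (hf : Nice f) (a : Fin 2) : Nice (pd a f) :=
  ⟨hf.1.pd a, fun n => (hf.2 (n + 1)).2 a⟩

lemma neg {f : Family} (hf : Nice f) : Nice (-f) := by
  have : -f = cst (-1) * f := by funext t p; simp
  rw [this]
  exact hf.cst_mul _

lemma sub {f g : Family} (hf : Nice f) (hg : Nice g) : Nice (f - g) := by
  rw [sub_eq_add_neg]
  exact hf.add hg.neg

lemma zero : Nice 0 := by
  have h0 : ∀ n, RapidDecayOrder n (0 : Family) := by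
    intro n
    induction n with
    | zero => exact fun T k => ⟨0, fun t _ p => by simp⟩
    | succ n ih =>
      refine ⟨fun T k => ⟨0, fun t _ p => by simp⟩, fun a => ?_⟩
      have : SpinTwoBEC.pd a (0 : Family) = 0 := pd_cst 0 a
      rw [this]
      exact ih
  exact ⟨sliceSmooth_cst 0, h0⟩

lemma sum {ι : Type*} (s : Finset ι) {f : ι → Family} (hf : ∀ i, Nice (f i)) :
    Nice (∑ i ∈ s, f i) := by
  classical
  induction s using Finset.induction_on with
  | empty => simpa using zero
  | insert i s hi ih => rw [Finset.sum_insert hi]; exact (hf i).add ih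

/-- A uniform integrable bound on a bounded time interval. -/
lemma exists_bound {f : Family} (hf : Nice f) (T : ℝ≥0) :
    ∃ C : ℝ, ∀ t ≤ T, ∀ p : Plane, ‖f t p‖ ≤ C * (1 + ‖p‖) ^ (-(3 : ℝ)) := by
  -- The powers 0 and 3 are combined into a bound by `(1 + ‖p‖)⁻³`, integrable because 3 exceeds the
  -- dimension 2.
  obtain ⟨C, hC⟩ := (hf.2 0) T 0
  obtain ⟨D, hD⟩ := (hf.2 0) T 3
  refine ⟨4 * (C + D), fun t ht p => ?_⟩
  have h1 := hC t ht p
  have h2 := hD t ht p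
  have h0 : (0 : ℝ) < 1 + ‖p‖ := by positivity
  have h3 : (1 + ‖p‖) ^ (-(3 : ℝ)) = ((1 + ‖p‖) ^ 3)⁻¹ := by
    rw [Real.rpow_neg h0.le]; norm_cast
  rw [h3, ← div_eq_mul_inv, le_div_iff₀ (by positivity)]
  -- With `r = ‖p‖`, the difference of the two sides is `3(1 + r)(1 - r)²`.
  have h4 : (1 + ‖p‖) ^ 3 ≤ 4 * (1 + ‖p‖ ^ 3) := by
    nlinarith [mul_nonneg h0.le (sq_nonneg (1 - ‖p‖)), norm_nonneg p]
  calc ‖f t p‖ * (1 + ‖p‖) ^ 3 ≤ ‖f t p‖ * (4 * (1 + ‖p‖ ^ 3)) := by gcongr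
    _ = 4 * (‖p‖ ^ 0 * ‖f t p‖ + ‖p‖ ^ 3 * ‖f t p‖) := by ring
    _ ≤ 4 * (C + D) := by gcongr

lemma _root_.SpinTwoBEC.integrable_majorant (C : ℝ) :
    Integrable (fun p : Plane => C * (1 + ‖p‖) ^ (-(3 : ℝ))) :=
  (integrable_one_add_norm (by simp; norm_num)).const_mul C

lemma continuous {f : Family} (hf : Nice f) (t : ℝ≥0) : Continuous (f t) := (hf.1 t).continuous

lemma integrable {f : Family} (hf : Nice f) (t : ℝ≥0) : Integrable (f t) := by
  obtain ⟨C, hC⟩ := hf.exists_bound t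
  exact (integrable_majorant C).mono' (hf.continuous t).aestronglyMeasurable
    (Eventually.of_forall (hC t le_rfl))

/-- Integration by parts against the constant function 1. This is what makes divergences invisible
to integrals. -/
lemma integral_pd {f : Family} (hf : Nice f) (a : Fin 2) (t : ℝ≥0) :
    ∫ p, SpinTwoBEC.pd a f t p = 0 := by
  have hi : Integrable fun p => fderiv ℝ (f t) p (EuclideanSpace.single a 1) :=
    (hf.pd a).integrable t
  have h := integral_mul_fderiv_eq_neg_fderiv_mul_of_integrable
    (μ := (volume : Measure Plane)) (f := fun _ : Plane => (1 : ℂ))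
    (g := f t) (v := EuclideanSpace.single a 1) (by simp) (by simpa using hi)
    (by simpa using hf.integrable t) (fun x _ => differentiableAt_const _)
    (fun x _ => hf.1.differentiableAt t x)
  simpa [SpinTwoBEC.pd] using h

end Nice

/-! ### Time derivatives -/

/-- `f'` is the time derivative of `f`, one-sided at `t = 0`. -/
structure TimeDeriv (f f' : Family) : Prop where
  nice : Nice f
  nice_deriv : Nice f'
  hasDerivWithinAt : ∀ (t : ℝ≥0) (p : Plane),
    HasDerivWithinAt (fun τ : ℝ => f τ.toNNReal p) (f' t p) (Set.Ici 0) t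

namespace TimeDeriv

lemma add {f f' g g' : Family} (hf : TimeDeriv f f') (hg : TimeDeriv g g') :
    TimeDeriv (f + g) (f' + g') :=
  ⟨hf.1.add hg.1, hf.2.add hg.2, fun t p => (hf.3 t p).add (hg.3 t p)⟩

lemma sub {f f' g g' : Family} (hf : TimeDeriv f f') (hg : TimeDeriv g g') :
    TimeDeriv (f - g) (f' - g') :=
  ⟨hf.1.sub hg.1, hf.2.sub hg.2, fun t p => (hf.3 t p).sub (hg.3 t p)⟩

lemma mul {f f' g g' : Family} (hf : TimeDeriv f f') (hg : TimeDeriv g g') :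
    TimeDeriv (f * g) (f' * g + f * g') :=
  ⟨hf.1.mul hg.1, (hf.2.mul hg.1).add (hf.1.mul hg.2), fun t p => by
    have h := (hf.3 t p).mul (hg.3 t p)
    simp only [Real.toNNReal_coe] at h
    exact h⟩

lemma star {f f' : Family} (hf : TimeDeriv f f') : TimeDeriv (star f) (star f') :=
  ⟨hf.1.star, hf.2.star, fun t p => (hf.3 t p).star⟩

lemma cst_mul {f f' : Family} (hf : TimeDeriv f f') (c : ℂ) :
    TimeDeriv (cst c * f) (cst c * f') :=
  ⟨hf.1.cst_mul c, hf.2.cst_mul c, fun t p => (hf.3 t p).const_mul c⟩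

lemma coord_mul {f f' : Family} (hf : TimeDeriv f f') (a : Fin 2) :
    TimeDeriv (coord a * f) (coord a * f') :=
  ⟨hf.1.coord_mul a, hf.2.coord_mul a, fun t p => (hf.3 t p).const_mul ((p a : ℝ) : ℂ)⟩

lemma zero : TimeDeriv 0 0 := ⟨Nice.zero, Nice.zero, fun _ _ => hasDerivWithinAt_const _ _ _⟩

/-- Differentiation under the integral sign. -/
lemma integral {f f' : Family} (hf : TimeDeriv f f') (t : ℝ≥0) :
    HasDerivWithinAt (fun τ : ℝ => ∫ p, f τ.toNNReal p) (∫ p, f' t p) (Set.Ici 0) t := by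
  obtain ⟨C, hC⟩ := hf.2.exists_bound (t + 1)
  rw [hasDerivWithinAt_iff_tendsto_slope]
  have hnear : ∀ᶠ τ : ℝ in 𝓝[Set.Ici 0 \ {(t : ℝ)}] (t : ℝ), τ ∈ Set.Icc (0 : ℝ) (t + 1) := by
    have h1 : Set.Iio ((t : ℝ) + 1) ∈ 𝓝 (t : ℝ) := Iio_mem_nhds (by linarith)
    filter_upwards [self_mem_nhdsWithin, mem_nhdsWithin_of_mem_nhds h1] with τ h2 h3
    exact ⟨h2.1, le_of_lt h3⟩
  have hlim := tendsto_integral_filter_of_dominated_convergence (μ := (volume : Measure Plane))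
    (l := 𝓝[Set.Ici 0 \ {(t : ℝ)}] (t : ℝ))
    (F := fun (τ : ℝ) p => slope (fun τ : ℝ => f τ.toNNReal p) t τ) (f := f' t)
    (fun p => C * (1 + ‖p‖) ^ (-(3 : ℝ)))
    (Eventually.of_forall fun τ => by
      simp only [slope_def_module]
      exact (((hf.1.continuous _).sub (hf.1.continuous _)).const_smul _).aestronglyMeasurable)
    (by
      filter_upwards [hnear] with τ hτ
      refine Eventually.of_forall fun p => ?_
      -- The mean value inequality bounds every difference quotient by the majorant of `f'`, which
      -- is uniform on `[0, t + 1]`.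
      have hmv := (convex_Icc (0 : ℝ) (t + 1)).norm_image_sub_le_of_norm_hasDerivWithin_le
        (f := fun τ : ℝ => f τ.toNNReal p) (f' := fun τ : ℝ => f' τ.toNNReal p)
        (C := C * (1 + ‖p‖) ^ (-(3 : ℝ))) (x := (t : ℝ)) (y := τ)
        (fun x hx => by
          have := hf.3 x.toNNReal p
          rw [Real.coe_toNNReal x hx.1] at this
          exact this.mono Set.Icc_subset_Ici_self)
        (fun x hx => hC _ (by
          rw [Real.toNNReal_le_iff_le_coe]; exact_mod_cast hx.2) p)
        ⟨t.2, by linarith⟩ hτ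
      rw [slope_def_module, norm_smul, norm_inv]
      -- `hnear` does not retain `τ ≠ t`; at `τ = t` the slope is zero by convention.
      rcases eq_or_ne τ t with h | h
      · subst h
        simp only [sub_self, norm_zero, inv_zero, zero_mul]
        exact le_trans (norm_nonneg _) (hC t (by simp) p)
      · have hpos : 0 < ‖τ - t‖ := norm_pos_iff.2 (sub_ne_zero.2 h)
        rw [inv_mul_le_iff₀ hpos, mul_comm ‖τ - t‖]
        exact hmv)
    (integrable_majorant C)
    (Eventually.of_forall fun p => hasDerivWithinAt_iff_tendsto_slope.1 (hf.3 t p))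
  refine hlim.congr fun τ => ?_
  simp only [slope_def_module]
  rw [integral_smul, integral_sub (hf.1.integrable _) (hf.1.integrable _)]

end TimeDeriv

/-! ### Interchange of time and space derivatives -/

/-- Joint smoothness in time and space. -/
def JointSmooth (f : Family) : Prop :=
  ContDiffOn ℝ ∞ (fun q : ℝ × Plane => f q.1.toNNReal q.2) (Set.Ici 0 ×ˢ Set.univ)

lemma uniqueDiffOn_halfSpace :
    UniqueDiffOn ℝ (Set.Ici (0 : ℝ) ×ˢ (Set.univ : Set Plane)) :=
  (uniqueDiffOn_Ici 0).prod uniqueDiffOn_univ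

/-- A whole time slice lies in the half-space, even at the boundary time 0, so space derivatives
within the half-space are ordinary ones. -/
lemma fderivWithin_space {E : Type*} [NormedAddCommGroup E] [NormedSpace ℝ E]
    {F : ℝ × Plane → E} {q : ℝ × Plane} (hq : 0 ≤ q.1)
    (hF : DifferentiableWithinAt ℝ F (Set.Ici 0 ×ˢ Set.univ) q) (v : Plane) :
    fderivWithin ℝ F (Set.Ici 0 ×ˢ Set.univ) q (0, v) =
      fderiv ℝ (fun y => F (q.1, y)) q.2 v := by
  have h1 : HasFDerivAt (fun y : Plane => (q.1, y)) (ContinuousLinearMap.inr ℝ ℝ Plane) q.2 :=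
    hasFDerivAt_prodMk_right q.1 q.2
  have h2 := HasFDerivWithinAt.comp (t := Set.Ici 0 ×ˢ Set.univ) q.2
    (f := fun y : Plane => (q.1, y)) hF.hasFDerivWithinAt
    (h1.hasFDerivWithinAt (s := Set.univ)) (fun y _ => ⟨hq, trivial⟩)
  rw [hasFDerivWithinAt_univ] at h2
  have h3 := h2.fderiv
  simp only [Function.comp_def] at h3
  rw [h3]
  simp

lemma hasDerivWithinAt_time {E : Type*} [NormedAddCommGroup E] [NormedSpace ℝ E]
    {F : ℝ × Plane → E} {q : ℝ × Plane}
    (hF : DifferentiableWithinAt ℝ F (Set.Ici 0 ×ˢ Set.univ) q) :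
    HasDerivWithinAt (fun τ => F (τ, q.2))
      (fderivWithin ℝ F (Set.Ici 0 ×ˢ Set.univ) q (1, 0)) (Set.Ici 0) q.1 := by
  have h1 : HasDerivAt (fun τ : ℝ => (τ, q.2)) ((1 : ℝ), (0 : Plane)) q.1 :=
    (hasDerivAt_id q.1).prodMk (hasDerivAt_const _ _)
  exact HasFDerivWithinAt.comp_hasDerivWithinAt (t := Set.Ici 0 ×ˢ Set.univ)
    (f := fun τ : ℝ => (τ, q.2)) q.1 hF.hasFDerivWithinAt h1.hasDerivWithinAt
    (fun τ hτ => ⟨hτ, trivial⟩)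

lemma JointSmooth.differentiableWithinAt {f : Family} (hf : JointSmooth f) {q : ℝ × Plane}
    (hq : q ∈ Set.Ici (0 : ℝ) ×ˢ (Set.univ : Set Plane)) :
    DifferentiableWithinAt ℝ (fun q : ℝ × Plane => f q.1.toNNReal q.2)
      (Set.Ici 0 ×ˢ Set.univ) q :=
  hf.differentiableOn (by simp) q hq

lemma JointSmooth.pd_eq {f : Family} (hf : JointSmooth f) (a : Fin 2) {q : ℝ × Plane}
    (hq : q ∈ Set.Ici (0 : ℝ) ×ˢ (Set.univ : Set Plane)) :
    pd a f q.1.toNNReal q.2 = fderivWithin ℝ (fun q : ℝ × Plane => f q.1.toNNReal q.2)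
      (Set.Ici 0 ×ˢ Set.univ) q (0, EuclideanSpace.single a 1) := by
  rw [fderivWithin_space hq.1 (hf.differentiableWithinAt hq)]
  rfl

lemma JointSmooth.pd {f : Family} (hf : JointSmooth f) (a : Fin 2) : JointSmooth (pd a f) :=
  ((hf.fderivWithin uniqueDiffOn_halfSpace (m := ∞) (by simp)).clm_apply
    contDiffOn_const).congr fun _ hq => hf.pd_eq a hq

/-- The mixed second derivatives of the jointly smooth function on the half-space agree, so the time
derivative passes through the space derivative, also at time 0. -/
lemma TimeDeriv.pd {f f' : Family} (hf : JointSmooth f) (h : TimeDeriv f f') (a : Fin 2) :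
    TimeDeriv (pd a f) (pd a f') := by
  refine ⟨h.1.pd a, h.2.pd a, fun t p => ?_⟩
  set s : Set (ℝ × Plane) := Set.Ici (0 : ℝ) ×ˢ (Set.univ : Set Plane) with hs
  set F : ℝ × Plane → ℂ := fun q => f q.1.toNNReal q.2 with hF
  have hq : ((t : ℝ), p) ∈ s := ⟨t.2, trivial⟩
  have hdiff : DifferentiableWithinAt ℝ (fderivWithin ℝ F s) s ((t : ℝ), p) :=
    (hf.fderivWithin uniqueDiffOn_halfSpace (m := ∞) (by simp)).differentiableOn (by simp) _ hq
  have happ : ∀ v, DifferentiableWithinAt ℝ (fun q => fderivWithin ℝ F s q v) s ((t : ℝ), p) :=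
    fun v => hdiff.clm_apply (differentiableWithinAt_const _)
  have happ' : ∀ v w, fderivWithin ℝ (fun q => fderivWithin ℝ F s q v) s ((t : ℝ), p) w =
      fderivWithin ℝ (fderivWithin ℝ F s) s ((t : ℝ), p) w v := by
    intro v w
    rw [fderivWithin_clm_apply (uniqueDiffOn_halfSpace _ hq) hdiff (differentiableWithinAt_const _)]
    simp [hs]
  have hsymm : IsSymmSndFDerivWithinAt ℝ F s ((t : ℝ), p) := by
    have h2 : ContDiffOn ℝ (2 : ℕ) F s := contDiffOn_infty.1 hf 2
    -- Symmetry at a boundary point needs that point to lie in the closure of the interior, which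
    -- holds for a closed half-space.
    refine (h2 _ hq).isSymmSndFDerivWithinAt (by simp) uniqueDiffOn_halfSpace ?_ hq
    rw [hs, interior_prod_eq, interior_Ici, interior_univ, closure_prod_eq, closure_Ioi]
    simp
  have hder := hasDerivWithinAt_time (happ (0, EuclideanSpace.single a 1))
  rw [happ', hsymm.eq, ← happ', fderivWithin_space t.2 (happ _)] at hder
  -- One-sided derivatives on `[0, ∞)` are unique, which identifies `f'` with the time component of
  -- the joint derivative.
  have htime : ∀ y, fderivWithin ℝ F s ((t : ℝ), y) (1, 0) = f' t y := by
    intro y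
    have h1 := hasDerivWithinAt_time (hf.differentiableWithinAt (q := ((t : ℝ), y)) ⟨t.2, trivial⟩)
    exact (uniqueDiffOn_Ici (0 : ℝ) _ t.2).eq_deriv _ h1 (h.3 t y)
  simp only [htime] at hder
  refine hder.congr (fun τ hτ => hf.pd_eq a (q := (τ, p)) ⟨hτ, trivial⟩) ?_
  exact hf.pd_eq a (q := ((t : ℝ), p)) hq

/-! ### Equality up to a divergence -/

/-- `f` and `g` differ by the divergence of a rapidly decreasing vector field. -/
def EqDiv (f g : Family) : Prop :=
  ∃ J : Fin 2 → Family, (∀ a, Nice (J a)) ∧ f = g + pd 0 (J 0) + pd 1 (J 1)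

namespace EqDiv

lemma of_eq {f g : Family} (h : f = g) : EqDiv f g :=
  ⟨fun _ => 0, fun _ => Nice.zero, by
    have : ∀ a, pd a (0 : Family) = 0 := fun a => pd_cst 0 a
    simp [h, this]⟩

lemma intro {f g : Family} (J₀ J₁ : Family) (h₀ : Nice J₀) (h₁ : Nice J₁)
    (h : f = g + pd 0 J₀ + pd 1 J₁) : EqDiv f g :=
  ⟨![J₀, J₁], Fin.forall_fin_two.2 ⟨h₀, h₁⟩, h⟩

lemma refl (f : Family) : EqDiv f f := of_eq rfl

lemma add {f g f' g' : Family} (h : EqDiv f g) (h' : EqDiv f' g') : EqDiv (f + f') (g + g') := by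
  obtain ⟨J, hJ, rfl⟩ := h
  obtain ⟨J', hJ', rfl⟩ := h'
  refine ⟨J + J', fun a => (hJ a).add (hJ' a), ?_⟩
  simp only [Pi.add_apply (f := J), pd_add (hJ _).1 (hJ' _).1]
  ring

lemma cst_mul {f g : Family} (h : EqDiv f g) (c : ℂ) : EqDiv (cst c * f) (cst c * g) := by
  obtain ⟨J, hJ, rfl⟩ := h
  refine ⟨fun a => cst c * J a, fun a => (hJ a).cst_mul c, ?_⟩
  simp only [pd_mul (sliceSmooth_cst c) (hJ _).1, pd_cst]
  ring

lemma neg {f g : Family} (h : EqDiv f g) : EqDiv (-f) (-g) := by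
  have := h.cst_mul (-1)
  have e : ∀ f : Family, cst (-1) * f = -f := fun f => by funext t p; simp
  rwa [e, e] at this

lemma sub {f g f' g' : Family} (h : EqDiv f g) (h' : EqDiv f' g') : EqDiv (f - f') (g - g') := by
  rw [sub_eq_add_neg, sub_eq_add_neg]
  exact h.add h'.neg

lemma symm {f g : Family} (h : EqDiv f g) : EqDiv g f := by
  have := (refl (f + g)).sub h
  convert this using 1 <;> ring

lemma trans {f g k : Family} (h : EqDiv f g) (h' : EqDiv g k) : EqDiv f k := by
  have := (h.add h').sub (refl g)
  convert this using 1 <;> ring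

lemma sum {ι : Type*} (s : Finset ι) {f g : ι → Family} (h : ∀ i, EqDiv (f i) (g i)) :
    EqDiv (∑ i ∈ s, f i) (∑ i ∈ s, g i) := by
  classical
  induction s using Finset.induction_on with
  | empty => simpa using refl 0
  | insert i s hi ih =>
    rw [Finset.sum_insert hi, Finset.sum_insert hi]
    exact (h i).add ih

lemma integral_eq {f g : Family} (h : EqDiv f g) (hg : Nice g) (t : ℝ≥0) :
    ∫ p, f t p = ∫ p, g t p := by
  obtain ⟨J, hJ, rfl⟩ := h
  have h0 := ((hJ 0).pd 0).integrable t
  have h1 := ((hJ 1).pd 1).integrable t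
  change ∫ p, (g t + pd 0 (J 0) t + pd 1 (J 1) t) p = _
  rw [integral_add' ((hg.integrable t).add h0) h1, integral_add' (hg.integrable t) h0,
    (hJ 0).integral_pd, (hJ 1).integral_pd]
  simp

end EqDiv

/-! ### Scalar operators -/

/-- The kinetic energy operator `-Δ/2`. -/
def kinetic (f : Family) : Family := cst (-(1 / 2)) * (pd 0 (pd 0 f) + pd 1 (pd 1 f))

/-- Multiplication by `x² + y²`. -/
def radiusSq (f : Family) : Family := coord 0 * (coord 0 * f) + coord 1 * (coord 1 * f)

/-- Angular momentum. -/
def angular (f : Family) : Family := cst (-Complex.I) * (coord 0 * pd 1 f - coord 1 * pd 0 f)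

/-- The antisymmetric generator of dilations `x ∂ₓ + y ∂_y + 1`. -/
def dilation (f : Family) : Family := coord 0 * pd 0 f + coord 1 * pd 1 f + f

lemma Nice.kinetic {f : Family} (hf : Nice f) : Nice (kinetic f) :=
  (((hf.pd 0).pd 0).add ((hf.pd 1).pd 1)).cst_mul _

lemma Nice.radiusSq {f : Family} (hf : Nice f) : Nice (radiusSq f) :=
  ((hf.coord_mul 0).coord_mul 0).add ((hf.coord_mul 1).coord_mul 1)

lemma Nice.angular {f : Family} (hf : Nice f) : Nice (angular f) :=
  (((hf.pd 1).coord_mul 0).sub ((hf.pd 0).coord_mul 1)).cst_mul _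

lemma Nice.dilation {f : Family} (hf : Nice f) : Nice (dilation f) :=
  (((hf.pd 0).coord_mul 0).add ((hf.pd 1).coord_mul 1)).add hf

@[simp] lemma pd_zero_coord_zero : pd 0 (coord 0) = 1 := by rw [pd_coord]; rfl
@[simp] lemma pd_one_coord_one : pd 1 (coord 1) = 1 := by rw [pd_coord]; rfl
@[simp] lemma pd_zero_coord_one : pd 0 (coord 1) = 0 := by rw [pd_coord]; rfl
@[simp] lemma pd_one_coord_zero : pd 1 (coord 0) = 0 := by rw [pd_coord]; rfl
@[simp] lemma pd_one_pd_zero {f : Family} (hf : SliceSmooth f) : pd 1 (pd 0 f) = pd 0 (pd 1 f) :=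
  pd_comm hf 1 0

section ScalarOperators

variable {f g : Family}

/-- Homogeneity: `-Δ/2` has degree `-2` under dilations. The same reasoning gives the coefficients
`-2` for `r²` and `0` for `L_z` in the next two commutators. -/
lemma kinetic_dilation (hf : Nice f) :
    kinetic (dilation f) = dilation (kinetic f) + cst 2 * kinetic f := by
  have h := hf.1
  funext t p
  simp (maxDischargeDepth := 20) [kinetic, dilation, h]
  ring

lemma radiusSq_dilation (hf : Nice f) :
    radiusSq (dilation f) = dilation (radiusSq f) - cst 2 * radiusSq f := by
  have h := hf.1
  funext t p
  simp (maxDischargeDepth := 20) [radiusSq, dilation, h]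
  ring

lemma angular_dilation (hf : Nice f) :
    angular (dilation f) = dilation (angular f) := by
  have h := hf.1
  funext t p
  simp (maxDischargeDepth := 20) [angular, dilation, h]
  ring

lemma kinetic_angular (hf : Nice f) :
    kinetic (angular f) = angular (kinetic f) := by
  have h := hf.1
  funext t p
  simp (maxDischargeDepth := 20) [kinetic, angular, h]
  ring

lemma angular_radiusSq (hf : Nice f) :
    angular (radiusSq f) = radiusSq (angular f) := by
  have h := hf.1
  funext t p
  simp (maxDischargeDepth := 20) [angular, radiusSq, h]
  ring

/-- The product rule yields `Δ(r²f) = r²Δf + 4x·∇f + 4f`. Since `Δr² = 4` in the plane, the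
zeroth-order term is exactly the `+1` in `dilation`. -/
lemma kinetic_radiusSq (hf : Nice f) :
    kinetic (radiusSq f) = radiusSq (kinetic f) - cst 2 * dilation f := by
  have h := hf.1
  funext t p
  simp (maxDischargeDepth := 20) [kinetic, radiusSq, dilation, h]
  ring

lemma kinetic_coord_zero_mul (hf : Nice f) :
    kinetic (coord 0 * f) = coord 0 * kinetic f - pd 0 f := by
  have h := hf.1
  funext t p
  simp (maxDischargeDepth := 20) [kinetic, h]
  ring

lemma kinetic_coord_one_mul (hf : Nice f) :
    kinetic (coord 1 * f) = coord 1 * kinetic f - pd 1 f := by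
  have h := hf.1
  funext t p
  simp (maxDischargeDepth := 20) [kinetic, h]
  ring

/-- Green's second identity; the witness is the usual flux. -/
lemma EqDiv.kinetic (hf : Nice f) (hg : Nice g) :
    EqDiv (star (kinetic f) * g) (star f * kinetic g) := by
  have h := hf.1
  have h' := hg.1
  refine EqDiv.intro (cst (-(1 / 2)) * (star (pd 0 f) * g - star f * pd 0 g))
    (cst (-(1 / 2)) * (star (pd 1 f) * g - star f * pd 1 g))
    ((((hf.pd 0).star.mul hg).sub (hf.star.mul (hg.pd 0))).cst_mul _)
    ((((hf.pd 1).star.mul hg).sub (hf.star.mul (hg.pd 1))).cst_mul _) ?_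
  funext t p
  simp (maxDischargeDepth := 20) [SpinTwoBEC.kinetic, h, h']
  ring

/-- Green's first identity, which links the gradient form of the kinetic energy to the operator
form. -/
lemma EqDiv.kinetic_grad (hf : Nice f) : EqDiv (star f * SpinTwoBEC.kinetic f)
    (cst (1 / 2) * (star (pd 0 f) * pd 0 f + star (pd 1 f) * pd 1 f)) := by
  have h := hf.1
  refine EqDiv.intro (cst (-(1 / 2)) * (star f * pd 0 f)) (cst (-(1 / 2)) * (star f * pd 1 f))
    ((hf.star.mul (hf.pd 0)).cst_mul _) ((hf.star.mul (hf.pd 1)).cst_mul _) ?_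
  funext t p
  simp (maxDischargeDepth := 20) [SpinTwoBEC.kinetic, h]
  ring

/-- The rotation field `(-y, x)` is divergence-free, so differentiating `f̄g` along it gives a pure
divergence. -/
lemma EqDiv.angular (hf : Nice f) (hg : Nice g) :
    EqDiv (star (angular f) * g) (star f * angular g) := by
  have h := hf.1
  have h' := hg.1
  refine EqDiv.intro (cst (-Complex.I) * (coord 1 * (star f * g)))
    (cst Complex.I * (coord 0 * (star f * g)))
    (((hf.star.mul hg).coord_mul 1).cst_mul _) (((hf.star.mul hg).coord_mul 0).cst_mul _) ?_
  funext t p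
  simp (maxDischargeDepth := 20) [SpinTwoBEC.angular, h, h']
  ring

/-- The field `(x, y)` has divergence 2, shared equally by the `+1` in the two dilations. -/
lemma EqDiv.dilation (hf : Nice f) (hg : Nice g) :
    EqDiv (star (dilation f) * g) (-(star f * dilation g)) := by
  have h := hf.1
  have h' := hg.1
  refine EqDiv.intro (coord 0 * (star f * g)) (coord 1 * (star f * g))
    ((hf.star.mul hg).coord_mul 0) ((hf.star.mul hg).coord_mul 1) ?_
  funext t p
  simp (maxDischargeDepth := 20) [SpinTwoBEC.dilation, h, h']
  ring

lemma star_radiusSq_mul (f g : Family) : star (radiusSq f) * g = star f * radiusSq g := by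
  funext t p
  simp [radiusSq]
  ring

end ScalarOperators

/-! ### Spinor operators -/

/-- Time-dependent spinor fields. -/
abbrev SpinorFamily : Type := Fin 5 → Family

/-- All components are rapidly decreasing. -/
def NiceSpinor (u : SpinorFamily) : Prop := ∀ l, Nice (u l)

/-- The sesquilinear density `uᴴ v`. -/
def dens (u v : SpinorFamily) : Family := ∑ l, star (u l) * v l

/-- A scalar operator acting on all components. -/
def lift (s : Family → Family) (u : SpinorFamily) : SpinorFamily := fun l => s (u l)

lemma lift_apply (s : Family → Family) (u : SpinorFamily) (l : Fin 5) :
    lift s u l = s (u l) := rfl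

/-- Multiplication by a constant. -/
def scale (c : ℂ) (u : SpinorFamily) : SpinorFamily := fun l => cst c * u l

/-- The action of `f_x`. -/
def spinX (u : SpinorFamily) : SpinorFamily :=
  ![u 1, u 0 + cst halfSqrt6 * u 2, cst halfSqrt6 * u 1 + cst halfSqrt6 * u 3,
    cst halfSqrt6 * u 2 + u 4, u 3]

/-- The action of `f_y`. -/
def spinY (u : SpinorFamily) : SpinorFamily :=
  ![cst Complex.I * -u 1, cst Complex.I * (u 0 - cst halfSqrt6 * u 2),
    cst Complex.I * (cst halfSqrt6 * u 1 - cst halfSqrt6 * u 3),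
    cst Complex.I * (cst halfSqrt6 * u 2 - u 4), cst Complex.I * u 3]

/-- The action of `f_z`. -/
def spinZ (u : SpinorFamily) : SpinorFamily :=
  ![cst 2 * u 0, u 1, 0, -u 3, cst (-2) * u 4]

/-- The operator `y f_x - x f_y`. -/
def spinMoment (u : SpinorFamily) : SpinorFamily :=
  fun l => coord 1 * spinX u l - coord 0 * spinY u l

/-- The spin-orbit operator `-𝒮 = -i (f_x ∂_y - f_y ∂ₓ)`. -/
def spinOrbit (u : SpinorFamily) : SpinorFamily :=
  fun l => cst (-Complex.I) * (spinX (lift (pd 1) u) l - spinY (lift (pd 0) u) l)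

lemma halfSqrt6_mul_self : halfSqrt6 * halfSqrt6 = 3 / 2 := by
  have h : Real.sqrt 6 * Real.sqrt 6 = 6 := Real.mul_self_sqrt (by norm_num)
  unfold halfSqrt6
  rw [← Complex.ofReal_mul, show Real.sqrt 6 / 2 * (Real.sqrt 6 / 2) = 3 / 2 by
    linear_combination h / 4]
  norm_num

@[simp] lemma conj_halfSqrt6 : (starRingEnd ℂ) halfSqrt6 = halfSqrt6 := Complex.conj_ofReal _

lemma NiceSpinor.add {u v : SpinorFamily} (hu : NiceSpinor u) (hv : NiceSpinor v) :
    NiceSpinor (u + v) := fun l => (hu l).add (hv l)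

lemma NiceSpinor.sub {u v : SpinorFamily} (hu : NiceSpinor u) (hv : NiceSpinor v) :
    NiceSpinor (u - v) := fun l => (hu l).sub (hv l)

lemma NiceSpinor.scale {u : SpinorFamily} (hu : NiceSpinor u) (c : ℂ) :
    NiceSpinor (scale c u) := fun l => (hu l).cst_mul c

lemma NiceSpinor.spinX {u : SpinorFamily} (hu : NiceSpinor u) : NiceSpinor (spinX u) := by
  intro l
  fin_cases l
  exacts [hu 1, (hu 0).add ((hu 2).cst_mul _), ((hu 1).cst_mul _).add ((hu 3).cst_mul _),
    ((hu 2).cst_mul _).add (hu 4), hu 3]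

lemma NiceSpinor.spinY {u : SpinorFamily} (hu : NiceSpinor u) : NiceSpinor (spinY u) := by
  intro l
  fin_cases l
  exacts [(hu 1).neg.cst_mul _, ((hu 0).sub ((hu 2).cst_mul _)).cst_mul _,
    (((hu 1).cst_mul _).sub ((hu 3).cst_mul _)).cst_mul _,
    (((hu 2).cst_mul _).sub (hu 4)).cst_mul _, (hu 3).cst_mul _]

lemma NiceSpinor.spinZ {u : SpinorFamily} (hu : NiceSpinor u) : NiceSpinor (spinZ u) := by
  intro l
  fin_cases l
  exacts [(hu 0).cst_mul _, hu 1, Nice.zero, (hu 3).neg, (hu 4).cst_mul _]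

lemma NiceSpinor.spinMoment {u : SpinorFamily} (hu : NiceSpinor u) :
    NiceSpinor (spinMoment u) :=
  fun l => ((hu.spinX l).coord_mul 1).sub ((hu.spinY l).coord_mul 0)

lemma NiceSpinor.lift_pd {u : SpinorFamily} (hu : NiceSpinor u) (a : Fin 2) :
    NiceSpinor (lift (pd a) u) := fun l => (hu l).pd a

lemma NiceSpinor.spinOrbit {u : SpinorFamily} (hu : NiceSpinor u) : NiceSpinor (spinOrbit u) :=
  fun l => (((hu.lift_pd 1).spinX l).sub ((hu.lift_pd 0).spinY l)).cst_mul _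

lemma Nice.dens {u v : SpinorFamily} (hu : NiceSpinor u) (hv : NiceSpinor v) :
    Nice (dens u v) := Nice.sum _ fun l => (hu l).star.mul (hv l)

/-- Linear operators preserving rapid decay. -/
structure LinearOp (O : SpinorFamily → SpinorFamily) : Prop where
  nice : ∀ {u}, NiceSpinor u → NiceSpinor (O u)
  add : ∀ {u v}, NiceSpinor u → NiceSpinor v → O (u + v) = O u + O v
  scale : ∀ {u} (c : ℂ), NiceSpinor u → O (scale c u) = SpinTwoBEC.scale c (O u)

/-- Symmetry with respect to the `L²` inner product. -/
def SymmOp (O : SpinorFamily → SpinorFamily) : Prop :=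
  ∀ u v, NiceSpinor u → NiceSpinor v → EqDiv (dens (O u) v) (dens u (O v))

/-! ### Linearity of the operators -/

section LinearOps

lemma linearOp_lift {s : Family → Family} (h : ∀ f, Nice f → Nice (s f))
    (h' : ∀ f g, Nice f → Nice g → s (f + g) = s f + s g)
    (h'' : ∀ f c, Nice f → s (cst c * f) = cst c * s f) : LinearOp (lift s) :=
  ⟨fun hu l => h _ (hu l), fun hu hv => funext fun l => h' _ _ (hu l) (hv l),
    fun c hu => funext fun l => h'' _ c (hu l)⟩

lemma linearOp_kinetic : LinearOp (lift kinetic) := by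
  refine linearOp_lift (fun f => Nice.kinetic) (fun f g hf hg => ?_) (fun f c hf => ?_)
  · have h := hf.1
    have h' := hg.1
    simp (maxDischargeDepth := 20) only [kinetic, pd_add, SliceSmooth.pd, h, h']
    ring
  · have h := hf.1
    simp (maxDischargeDepth := 20) [kinetic, h]
    ring

lemma linearOp_radiusSq : LinearOp (lift radiusSq) := by
  refine linearOp_lift (fun f => Nice.radiusSq) (fun f g hf hg => ?_) (fun f c hf => ?_) <;>
  · simp only [radiusSq]
    ring

lemma linearOp_angular : LinearOp (lift angular) := by
  refine linearOp_lift (fun f => Nice.angular) (fun f g hf hg => ?_) (fun f c hf => ?_)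
  · have h := hf.1
    have h' := hg.1
    simp only [angular, pd_add, h, h']
    ring
  · have h := hf.1
    simp [angular, h]
    ring

/-- The symmetric generator of dilations. -/
def symmDilation (f : Family) : Family := cst (-Complex.I) * dilation f

lemma linearOp_symmDilation : LinearOp (lift symmDilation) := by
  refine linearOp_lift (fun f hf => hf.dilation.cst_mul _) (fun f g hf hg => ?_)
    (fun f c hf => ?_)
  · have h := hf.1
    have h' := hg.1
    simp only [symmDilation, dilation, pd_add, h, h']
    ring
  · have h := hf.1
    simp [symmDilation, dilation, h]
    ring

lemma spinX_add (u v : SpinorFamily) : spinX (u + v) = spinX u + spinX v := by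
  funext l
  fin_cases l <;> simp [spinX] <;> ring

lemma spinX_scale (c : ℂ) (u : SpinorFamily) : spinX (scale c u) = scale c (spinX u) := by
  funext l
  fin_cases l <;> simp [spinX, scale] <;> ring

lemma spinY_add (u v : SpinorFamily) : spinY (u + v) = spinY u + spinY v := by
  funext l
  fin_cases l <;> simp [spinY] <;> ring

lemma spinY_scale (c : ℂ) (u : SpinorFamily) : spinY (scale c u) = scale c (spinY u) := by
  funext l
  fin_cases l <;> simp [spinY, scale] <;> ring

lemma linearOp_spinMoment : LinearOp spinMoment := by
  refine ⟨NiceSpinor.spinMoment, fun hu hv => ?_, fun c hu => ?_⟩ <;> funext l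
  · simp only [spinMoment, spinX_add, spinY_add, Pi.add_apply (ι := Fin 5)]
    ring
  · simp only [spinMoment, spinX_scale, spinY_scale, scale]
    ring

lemma lift_pd_add {u v : SpinorFamily} (hu : NiceSpinor u) (hv : NiceSpinor v) (a : Fin 2) :
    lift (pd a) (u + v) = lift (pd a) u + lift (pd a) v :=
  funext fun l => pd_add (hu l).1 (hv l).1 a

lemma lift_pd_scale {u : SpinorFamily} (hu : NiceSpinor u) (c : ℂ) (a : Fin 2) :
    lift (pd a) (scale c u) = scale c (lift (pd a) u) :=
  funext fun l => by simp [lift, scale, (hu l).1]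

lemma linearOp_spinOrbit : LinearOp spinOrbit := by
  refine ⟨NiceSpinor.spinOrbit, fun hu hv => ?_, fun c hu => ?_⟩ <;> funext l
  · simp only [spinOrbit, lift_pd_add hu hv, spinX_add, spinY_add, Pi.add_apply (ι := Fin 5)]
    ring
  · simp only [spinOrbit, lift_pd_scale hu, spinX_scale, spinY_scale, scale]
    ring

lemma LinearOp.addOp {O O' : SpinorFamily → SpinorFamily} (h : LinearOp O) (h' : LinearOp O') :
    LinearOp (fun u => O u + O' u) :=
  ⟨fun hu => (h.nice hu).add (h'.nice hu), fun hu hv => by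
    simp only [h.add hu hv, h'.add hu hv]; abel, fun c hu => by
    simp only [h.scale c hu, h'.scale c hu]; funext l; simp [SpinTwoBEC.scale, mul_add]⟩

lemma LinearOp.scaleOp {O : SpinorFamily → SpinorFamily} (h : LinearOp O) (a : ℂ) :
    LinearOp (fun u => SpinTwoBEC.scale a (O u)) :=
  ⟨fun hu => (h.nice hu).scale a, fun hu hv => by
    simp only [h.add hu hv]; funext l; simp [SpinTwoBEC.scale, mul_add], fun c hu => by
    simp only [h.scale c hu]; funext l; simp only [SpinTwoBEC.scale]; ring⟩

end LinearOps

/-! ### Symmetry with respect to the `L²` inner product -/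

section Symmetry

lemma dens_add_left (u v w : SpinorFamily) : dens (u + v) w = dens u w + dens v w := by
  simp [dens, add_mul, Finset.sum_add_distrib]

lemma dens_add_right (u v w : SpinorFamily) : dens u (v + w) = dens u v + dens u w := by
  simp [dens, mul_add, Finset.sum_add_distrib]

lemma star_cst (c : ℂ) : star (cst c) = cst (star c) := rfl

lemma dens_scale_left (c : ℂ) (u v : SpinorFamily) :
    dens (scale c u) v = cst (star c) * dens u v := by
  simp only [dens, scale, star_mul', star_cst, Finset.mul_sum, mul_assoc]

lemma dens_scale_right (c : ℂ) (u v : SpinorFamily) :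
    dens u (scale c v) = cst c * dens u v := by
  simp only [dens, scale, Finset.mul_sum]
  exact Finset.sum_congr rfl fun l _ => by ring

lemma symmOp_lift {s : Family → Family}
    (h : ∀ f g, Nice f → Nice g → EqDiv (star (s f) * g) (star f * s g)) : SymmOp (lift s) :=
  fun _ _ hu hv => EqDiv.sum _ fun l => h _ _ (hu l) (hv l)

lemma SymmOp.addOp {O O' : SpinorFamily → SpinorFamily} (h : SymmOp O) (h' : SymmOp O') :
    SymmOp (fun u => O u + O' u) := fun u v hu hv => by
  simp only [dens_add_left, dens_add_right]
  exact (h u v hu hv).add (h' u v hu hv)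

lemma SymmOp.scaleOp {O : SpinorFamily → SpinorFamily} (h : SymmOp O) (a : ℝ) :
    SymmOp (fun u => scale (a : ℂ) (O u)) := fun u v hu hv => by
  simp only [dens_scale_left, dens_scale_right]
  have : star (a : ℂ) = a := Complex.conj_ofReal a
  rw [this]
  exact (h u v hu hv).cst_mul _

lemma symmOp_kinetic : SymmOp (lift kinetic) := symmOp_lift fun _ _ => EqDiv.kinetic
lemma symmOp_angular : SymmOp (lift angular) := symmOp_lift fun _ _ => EqDiv.angular
lemma symmOp_radiusSq : SymmOp (lift radiusSq) :=
  symmOp_lift fun f g _ _ => EqDiv.of_eq (star_radiusSq_mul f g)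

lemma symmOp_symmDilation : SymmOp (lift symmDilation) := symmOp_lift fun f g hf hg => by
  have h := ((EqDiv.dilation hf hg).cst_mul Complex.I)
  convert h using 1
  · funext t p; simp [symmDilation]; ring
  · funext t p; simp [symmDilation]; ring

/-- The matrix `f_x` is Hermitian, so the identity is pointwise and needs no integration by parts;
likewise for `f_y` and `f_z`. -/
lemma dens_spinX (u v : SpinorFamily) : dens (spinX u) v = dens u (spinX v) := by
  funext t p
  simp [dens, spinX, Fin.sum_univ_five]
  ring

lemma dens_spinY (u v : SpinorFamily) : dens (spinY u) v = dens u (spinY v) := by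
  funext t p
  simp [dens, spinY, Fin.sum_univ_five]
  ring

lemma dens_spinZ (u v : SpinorFamily) : dens (spinZ u) v = dens u (spinZ v) := by
  funext t p
  simp [dens, spinZ, Fin.sum_univ_five, map_ofNat]
  ring

lemma dens_coord_sub_left (u v w : SpinorFamily) :
    dens (fun l => coord 1 * u l - coord 0 * v l) w = coord 1 * dens u w - coord 0 * dens v w := by
  funext t p
  simp [dens, Fin.sum_univ_five]
  ring

lemma dens_coord_sub_right (u v w : SpinorFamily) :
    dens u (fun l => coord 1 * v l - coord 0 * w l) = coord 1 * dens u v - coord 0 * dens u w := by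
  funext t p
  simp [dens, Fin.sum_univ_five]
  ring

lemma dens_spinMoment (u v : SpinorFamily) : dens (spinMoment u) v = dens u (spinMoment v) := by
  unfold spinMoment
  rw [dens_coord_sub_left, dens_coord_sub_right, dens_spinX, dens_spinY]

lemma symmOp_spinMoment : SymmOp spinMoment :=
  fun u v _ _ => EqDiv.of_eq (dens_spinMoment u v)

lemma pd_sum {ι : Type*} (s : Finset ι) {f : ι → Family} (hf : ∀ i, SliceSmooth (f i))
    (a : Fin 2) : pd a (∑ i ∈ s, f i) = ∑ i ∈ s, pd a (f i) := by
  classical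
  have : SliceSmooth (∑ i ∈ s, f i) ∧ pd a (∑ i ∈ s, f i) = ∑ i ∈ s, pd a (f i) := by
    induction s using Finset.induction_on with
    | empty => exact ⟨sliceSmooth_cst 0, pd_cst 0 a⟩
    | insert i s hi ih =>
      rw [Finset.sum_insert hi, Finset.sum_insert hi]
      exact ⟨(hf i).add ih.1, by rw [pd_add (hf i) ih.1, ih.2]⟩
  exact this.2

lemma pd_dens {u v : SpinorFamily} (hu : NiceSpinor u) (hv : NiceSpinor v) (a : Fin 2) :
    pd a (dens u v) = dens (lift (pd a) u) v + dens u (lift (pd a) v) := by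
  unfold dens
  rw [pd_sum _ fun l => (hu l).star.1.mul (hv l).1, ← Finset.sum_add_distrib]
  refine Finset.sum_congr rfl fun l _ => ?_
  rw [pd_mul (hu l).star.1 (hv l).1, pd_star (hu l).1]
  rfl

lemma lift_pd_spinX {u : SpinorFamily} (hu : NiceSpinor u) (a : Fin 2) :
    lift (pd a) (spinX u) = spinX (lift (pd a) u) := by
  have h := fun l => (hu l).1
  funext l
  fin_cases l <;> simp (maxDischargeDepth := 20) [spinX, lift, h]

lemma lift_pd_spinY {u : SpinorFamily} (hu : NiceSpinor u) (a : Fin 2) :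
    lift (pd a) (spinY u) = spinY (lift (pd a) u) := by
  have h := fun l => (hu l).1
  funext l
  fin_cases l <;> simp (maxDischargeDepth := 20) [spinY, lift, h]

/-- The Hermitian matrices are constant and commute with derivatives, so only the derivatives have
to be moved; the flux has components `-i uᴴ f_y v` and `i uᴴ f_x v`. -/
lemma symmOp_spinOrbit : SymmOp spinOrbit := fun u v hu hv => by
  refine EqDiv.intro (cst (-Complex.I) * dens u (spinY v)) (cst Complex.I * dens u (spinX v))
    ((Nice.dens hu hv.spinY).cst_mul _) ((Nice.dens hu hv.spinX).cst_mul _) ?_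
  rw [pd_mul (sliceSmooth_cst _) (Nice.dens hu hv.spinY).1,
    pd_mul (sliceSmooth_cst _) (Nice.dens hu hv.spinX).1, pd_cst, pd_cst, pd_dens hu hv.spinY,
    pd_dens hu hv.spinX, lift_pd_spinX hv, lift_pd_spinY hv,
    ← dens_spinX (lift (pd 1) u), ← dens_spinY (lift (pd 0) u)]
  funext t p
  simp [dens, spinOrbit, Fin.sum_univ_five]
  ring

end Symmetry

/-! ### Commutators of the spin operators with the terms of the Hamiltonian -/

section SpinCommutators

variable {u : SpinorFamily}

/-- The spin-orbit operator is of first order with constant coefficients, hence homogeneous of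
degree `-1`. -/
lemma spinOrbit_dilation (hu : NiceSpinor u) :
    spinOrbit (lift dilation u) = lift dilation (spinOrbit u) + spinOrbit u := by
  have h := fun l => (hu l).1
  funext l
  fin_cases l <;> funext t p <;>
    simp (maxDischargeDepth := 20) [spinOrbit, spinX, spinY, lift, dilation, h] <;> ring

/-- The derivatives falling on `r²` produce `2y f_x - 2x f_y`. This is how `spinMoment` enters the
first derivative of `δ_r`. -/
lemma spinOrbit_radiusSq (hu : NiceSpinor u) :
    spinOrbit (lift radiusSq u) =
      lift radiusSq (spinOrbit u) + scale (-2 * Complex.I) (spinMoment u) := by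
  have h := fun l => (hu l).1
  funext l
  fin_cases l <;> funext t p <;>
    simp (maxDischargeDepth := 20) [spinOrbit, spinX, spinY, spinMoment, lift, scale, radiusSq,
      h] <;> ring

lemma spinX_coord_mul (a : Fin 2) (u : SpinorFamily) :
    spinX (fun l => coord a * u l) = fun l => coord a * spinX u l := by
  funext l
  fin_cases l <;> simp [spinX] <;> ring

lemma spinY_coord_mul (a : Fin 2) (u : SpinorFamily) :
    spinY (fun l => coord a * u l) = fun l => coord a * spinY u l := by
  funext l
  fin_cases l <;> simp [spinY] <;> ring

lemma spinX_sub (u v : SpinorFamily) : spinX (u - v) = spinX u - spinX v := by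
  funext l
  fin_cases l <;> simp [spinX] <;> ring

lemma spinY_sub (u v : SpinorFamily) : spinY (u - v) = spinY u - spinY v := by
  funext l
  fin_cases l <;> simp [spinY] <;> ring

/-- The `su(2)` relation `[f_x, f_y] = i f_z`; in the rows of `ψ₁` and `ψ₋₁` it rests on `(√6/2)² =
3/2`. -/
lemma spinX_spinY (u : SpinorFamily) :
    spinX (spinY u) = spinY (spinX u) + scale Complex.I (spinZ u) := by
  have h6 := halfSqrt6_mul_self
  funext l t p
  fin_cases l <;> simp [spinX, spinY, spinZ, scale]
  · ring
  · linear_combination (2 * Complex.I * u 1 t p) * h6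
  · ring
  · linear_combination (-2 * Complex.I * u 3 t p) * h6
  · ring

lemma spinMoment_eq (u : SpinorFamily) : spinMoment u =
    (fun l => coord 1 * spinX u l) - fun l => coord 0 * spinY u l := rfl

lemma lift_pd_spinMoment (hu : NiceSpinor u) (a : Fin 2) :
    lift (pd a) (spinMoment u) = spinMoment (lift (pd a) u) +
      (fun l => pd a (coord 1) * spinX u l) - fun l => pd a (coord 0) * spinY u l := by
  funext l
  have hX : ∀ l, pd a (spinX u l) = spinX (lift (pd a) u) l :=
    fun l => congrFun (lift_pd_spinX hu a) l
  have hY : ∀ l, pd a (spinY u l) = spinY (lift (pd a) u) l :=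
    fun l => congrFun (lift_pd_spinY hu a) l
  have h1 := (hu.spinX l).1
  have h2 := (hu.spinY l).1
  simp only [lift_apply, spinMoment, Pi.add_apply (ι := Fin 5), Pi.sub_apply (ι := Fin 5),
    pd_sub, pd_mul, SliceSmooth.mul, sliceSmooth_coord, h1, h2]
  rw [hX, hY]
  ring

lemma lift_pd_spinZ (hu : NiceSpinor u) (a : Fin 2) :
    lift (pd a) (spinZ u) = spinZ (lift (pd a) u) := by
  have h := fun l => (hu l).1
  have h0 : pd a 0 = 0 := pd_cst 0 a
  funext l
  fin_cases l <;> simp (maxDischargeDepth := 20) [spinZ, lift, h, h0]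

/-- Derivatives falling on the coordinates give `f_x² + f_y²`. The first-order terms differ only by
the order of the matrices, and `[f_x, f_y] = i f_z` turns their difference into `L_z f_z`. -/
lemma spinOrbit_spinMoment (hu : NiceSpinor u) :
    spinOrbit (spinMoment u) = spinMoment (spinOrbit u) + scale (-Complex.I)
      (spinX (spinX u) + spinY (spinY u) + lift angular (spinZ u)) := by
  have e1 : lift (pd 1) (spinMoment u) = spinMoment (lift (pd 1) u) + spinX u := by
    rw [lift_pd_spinMoment hu]
    funext l
    simp
  have e0 : lift (pd 0) (spinMoment u) = spinMoment (lift (pd 0) u) - spinY u := by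
    rw [lift_pd_spinMoment hu]
    funext l
    simp
  have eK : spinOrbit u =
      scale (-Complex.I) (spinX (lift (pd 1) u) - spinY (lift (pd 0) u)) := rfl
  have eZ : ∀ a l, pd a (spinZ u l) = spinZ (lift (pd a) u) l :=
    fun a l => congrFun (lift_pd_spinZ hu a) l
  rw [eK, linearOp_spinMoment.scale _
    ((hu.lift_pd 1).spinX.sub (hu.lift_pd 0).spinY)]
  funext l
  simp only [spinOrbit, e1, e0]
  simp only [spinMoment_eq, spinX_add, spinX_sub, spinY_sub, spinX_coord_mul,
    spinY_coord_mul, spinX_spinY]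
  funext t p
  simp [scale, lift_apply, angular, eZ]
  ring

/-- The coefficients of `spinMoment` are linear in position, so the commutator contains only their
gradients contracted with `∇`, which reassemble into the spin-orbit operator. -/
lemma kinetic_spinMoment (hu : NiceSpinor u) :
    lift kinetic (spinMoment u) =
      spinMoment (lift kinetic u) + scale (-Complex.I) (spinOrbit u) := by
  have hX : ∀ a l, pd a (spinX u l) = spinX (lift (pd a) u) l :=
    fun a l => congrFun (lift_pd_spinX hu a) l
  have hY : ∀ a l, pd a (spinY u l) = spinY (lift (pd a) u) l :=
    fun a l => congrFun (lift_pd_spinY hu a) l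
  have hX' : ∀ l, kinetic (spinX u l) = spinX (lift kinetic u) l := by
    have h := fun l => (hu l).1
    intro l
    fin_cases l <;> simp (maxDischargeDepth := 20) [kinetic, spinX, lift, h] <;> ring
  have hY' : ∀ l, kinetic (spinY u l) = spinY (lift kinetic u) l := by
    have h := fun l => (hu l).1
    intro l
    fin_cases l <;> simp (maxDischargeDepth := 20) [kinetic, spinY, lift, h] <;> ring
  funext l
  have e : ∀ f g, Nice f → Nice g → kinetic (f - g) = kinetic f - kinetic g := by
    intro f g hf hg
    have h := hf.1
    have h' := hg.1
    simp (maxDischargeDepth := 20) only [kinetic, pd_sub, SliceSmooth.pd, h, h']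
    ring
  rw [lift, spinMoment, e _ _ ((hu.spinX l).coord_mul 1) ((hu.spinY l).coord_mul 0),
    kinetic_coord_one_mul (hu.spinX l), kinetic_coord_zero_mul (hu.spinY l), hX, hY, hX', hY']
  funext t p
  simp [spinMoment, spinOrbit, scale]
  linear_combination (spinY (lift (pd 0) u) l t p - spinX (lift (pd 1) u) l t p) *
    Complex.I_sq

lemma radiusSq_spinMoment (u : SpinorFamily) :
    lift radiusSq (spinMoment u) = spinMoment (lift radiusSq u) := by
  funext l
  fin_cases l <;> funext t p <;>
    simp [spinX, spinY, spinMoment, lift, radiusSq] <;> ring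

/-- `L_z` acts on the coefficients by `L_z y = -ix` and `L_z x = iy`. -/
lemma angular_spinMoment (hu : NiceSpinor u) :
    lift angular (spinMoment u) = spinMoment (lift angular u) +
      scale (-Complex.I) (fun l => coord 0 * spinX u l + coord 1 * spinY u l) := by
  have h := fun l => (hu l).1
  funext l
  fin_cases l <;> funext t p <;>
    simp (maxDischargeDepth := 20) [spinX, spinY, spinMoment, lift, scale, angular,
      h] <;> ring

end SpinCommutators

/-! ### The nonlinear interaction -/

/-- The singlet amplitude `A₀₀`. -/
def singlet (u : SpinorFamily) : Family :=
  cst ((1 / Real.sqrt 5 : ℝ) : ℂ) * (cst 2 * (u 0 * u 4) - cst 2 * (u 1 * u 3) + u 2 * u 2)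

/-- The conjugate pairing field `A Ψ̄`. -/
def pairing (u : SpinorFamily) : SpinorFamily :=
  scale ((1 / Real.sqrt 5 : ℝ) : ℂ) ![star (u 4), -star (u 3), star (u 2), -star (u 1), star (u 0)]

/-- The nonlinear part of the Gross-Pitaevskii equations. -/
def Params.nonlin (P : Params) (u : SpinorFamily) : SpinorFamily := fun l =>
  cst P.c₀ * (dens u u * u l)
    + cst P.c₁ * (dens u (spinX u) * spinX u l + dens u (spinY u) * spinY u l
      + dens u (spinZ u) * spinZ u l)
    + cst P.c₂ * (singlet u * pairing u l)

/-- The interaction energy density. -/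
def Params.interaction (P : Params) (u : SpinorFamily) : Family :=
  cst (P.c₀ / 2) * (dens u u * dens u u)
    + cst (P.c₁ / 2) * (dens u (spinX u) * dens u (spinX u) + dens u (spinY u) * dens u (spinY u)
      + dens u (spinZ u) * dens u (spinZ u))
    + cst (P.c₂ / 2) * (star (singlet u) * singlet u)

/-- The derivative of the interaction energy density in direction `w`. -/
def Params.dInteraction (P : Params) (u w : SpinorFamily) : Family :=
  dens (P.nonlin u) w + dens w (P.nonlin u)

lemma Nice.singlet {u : SpinorFamily} (hu : NiceSpinor u) : Nice (singlet u) :=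
  (((((hu 0).mul (hu 4)).cst_mul _).sub (((hu 1).mul (hu 3)).cst_mul _)).add
    ((hu 2).mul (hu 2))).cst_mul _

lemma NiceSpinor.pairing {u : SpinorFamily} (hu : NiceSpinor u) : NiceSpinor (pairing u) := by
  refine NiceSpinor.scale (fun l => ?_) _
  fin_cases l
  exacts [(hu 4).star, (hu 3).star.neg, (hu 2).star, (hu 1).star.neg, (hu 0).star]

lemma NiceSpinor.nonlin {u : SpinorFamily} (hu : NiceSpinor u) (P : Params) :
    NiceSpinor (P.nonlin u) := fun l =>
  ((((Nice.dens hu hu).mul (hu l)).cst_mul _).add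
    (((((Nice.dens hu hu.spinX).mul (hu.spinX l)).add
      ((Nice.dens hu hu.spinY).mul (hu.spinY l))).add
      ((Nice.dens hu hu.spinZ).mul (hu.spinZ l))).cst_mul _)).add
    (((Nice.singlet hu).mul (hu.pairing l)).cst_mul _)

lemma Nice.interaction {u : SpinorFamily} (hu : NiceSpinor u) (P : Params) :
    Nice (P.interaction u) :=
  ((((Nice.dens hu hu).mul (Nice.dens hu hu)).cst_mul _).add
    (((((Nice.dens hu hu.spinX).mul (Nice.dens hu hu.spinX)).add
      ((Nice.dens hu hu.spinY).mul (Nice.dens hu hu.spinY))).add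
      ((Nice.dens hu hu.spinZ).mul (Nice.dens hu hu.spinZ))).cst_mul _)).add
    (((Nice.singlet hu).star.mul (Nice.singlet hu)).cst_mul _)

lemma star_dens (u v : SpinorFamily) : star (dens u v) = dens v u := by
  simp only [dens, star_sum, star_mul', star_star]
  exact Finset.sum_congr rfl fun l _ => mul_comm _ _

/-- Relations obeying the rules of differentiation. -/
structure DerivRules (D : Family → Family → Prop) : Prop where
  add : ∀ {f f' g g'}, D f f' → D g g' → D (f + g) (f' + g')
  sub : ∀ {f f' g g'}, D f f' → D g g' → D (f - g) (f' - g')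
  mul : ∀ {f f' g g'}, D f f' → D g g' → D (f * g) (f' * g + f * g')
  star : ∀ {f f'}, D f f' → D (star f) (star f')
  cst_mul : ∀ {f f'} (c : ℂ), D f f' → D (cst c * f) (cst c * f')
  zero : D 0 0

lemma derivRules_time : DerivRules TimeDeriv :=
  ⟨TimeDeriv.add, TimeDeriv.sub, TimeDeriv.mul, TimeDeriv.star, fun c h => h.cst_mul c,
    TimeDeriv.zero⟩

lemma derivRules_space (a : Fin 2) : DerivRules fun f f' => SliceSmooth f ∧ pd a f = f' := by
  refine ⟨?_, ?_, ?_, ?_, ?_, ?_⟩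
  · rintro f _ g _ ⟨hf, rfl⟩ ⟨hg, rfl⟩
    exact ⟨hf.add hg, pd_add hf hg a⟩
  · rintro f _ g _ ⟨hf, rfl⟩ ⟨hg, rfl⟩
    exact ⟨hf.sub hg, pd_sub hf hg a⟩
  · rintro f _ g _ ⟨hf, rfl⟩ ⟨hg, rfl⟩
    exact ⟨hf.mul hg, pd_mul hf hg a⟩
  · rintro f _ ⟨hf, rfl⟩
    exact ⟨hf.star, pd_star hf a⟩
  · rintro f _ c ⟨hf, rfl⟩
    exact ⟨(sliceSmooth_cst c).mul hf, by simp [hf]⟩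
  · exact ⟨sliceSmooth_cst 0, pd_cst 0 a⟩

/-! ### Differentiating the interaction energy -/

section DerivRules

variable {D : Family → Family → Prop} {u w v z : SpinorFamily}

lemma DerivRules.sum (hD : DerivRules D) {ι : Type*} (s : Finset ι) {f f' : ι → Family}
    (hf : ∀ i, D (f i) (f' i)) : D (∑ i ∈ s, f i) (∑ i ∈ s, f' i) := by
  classical
  induction s using Finset.induction_on with
  | empty => simpa using hD.zero
  | insert i s hi ih =>
    rw [Finset.sum_insert hi, Finset.sum_insert hi]
    exact hD.add (hf i) ih

lemma DerivRules.neg (hD : DerivRules D) {f f' : Family} (hf : D f f') : D (-f) (-f') := by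
  simpa using hD.sub hD.zero hf

lemma DerivRules.dens (hD : DerivRules D) (hu : ∀ l, D (u l) (w l)) (hv : ∀ l, D (v l) (z l)) :
    D (dens u v) (dens w v + dens u z) := by
  have h := hD.sum Finset.univ fun l => hD.mul (hD.star (hu l)) (hv l)
  simpa only [SpinTwoBEC.dens, Finset.sum_add_distrib] using h

lemma DerivRules.spinX (hD : DerivRules D) (hu : ∀ l, D (u l) (w l)) (l : Fin 5) :
    D (spinX u l) (spinX w l) := by
  fin_cases l
  exacts [hu 1, hD.add (hu 0) (hD.cst_mul _ (hu 2)),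
    hD.add (hD.cst_mul _ (hu 1)) (hD.cst_mul _ (hu 3)), hD.add (hD.cst_mul _ (hu 2)) (hu 4), hu 3]

lemma DerivRules.spinY (hD : DerivRules D) (hu : ∀ l, D (u l) (w l)) (l : Fin 5) :
    D (spinY u l) (spinY w l) := by
  fin_cases l
  exacts [hD.cst_mul _ (hD.neg (hu 1)), hD.cst_mul _ (hD.sub (hu 0) (hD.cst_mul _ (hu 2))),
    hD.cst_mul _ (hD.sub (hD.cst_mul _ (hu 1)) (hD.cst_mul _ (hu 3))),
    hD.cst_mul _ (hD.sub (hD.cst_mul _ (hu 2)) (hu 4)), hD.cst_mul _ (hu 3)]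

lemma DerivRules.spinZ (hD : DerivRules D) (hu : ∀ l, D (u l) (w l)) (l : Fin 5) :
    D (spinZ u l) (spinZ w l) := by
  fin_cases l
  exacts [hD.cst_mul _ (hu 0), hu 1, hD.zero, hD.neg (hu 3), hD.cst_mul _ (hu 4)]

/-- `A₀₀` is the quadratic form of a symmetric real matrix, hence the factor 2; `dens` conjugates
the already conjugated `pairing` back. -/
lemma DerivRules.singlet (hD : DerivRules D) (hu : ∀ l, D (u l) (w l)) :
    D (singlet u) (cst 2 * SpinTwoBEC.dens (pairing u) w) := by
  have h := hD.cst_mul ((1 / Real.sqrt 5 : ℝ) : ℂ)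
    (hD.add (hD.sub (hD.cst_mul 2 (hD.mul (hu 0) (hu 4))) (hD.cst_mul 2 (hD.mul (hu 1) (hu 3))))
      (hD.mul (hu 2) (hu 2)))
  convert h using 1
  · rfl
  · funext t p
    simp [SpinTwoBEC.dens, pairing, scale, Fin.sum_univ_five]
    ring

/-- The density and the spin components are real, so conjugation leaves these coefficients unchanged
and affects only `singlet`. -/
lemma dens_nonlin_left (P : Params) (u w : SpinorFamily) : dens (P.nonlin u) w =
    cst P.c₀ * (dens u u * dens u w) + cst P.c₁ * (dens u (spinX u) * dens (spinX u) w
      + dens u (spinY u) * dens (spinY u) w + dens u (spinZ u) * dens (spinZ u) w)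
      + cst P.c₂ * (star (singlet u) * dens (pairing u) w) := by
  have h1 : star (dens u u) = dens u u := star_dens u u
  have h2 : star (dens u (spinX u)) = dens u (spinX u) := by rw [star_dens, dens_spinX]
  have h3 : star (dens u (spinY u)) = dens u (spinY u) := by rw [star_dens, dens_spinY]
  have h4 : star (dens u (spinZ u)) = dens u (spinZ u) := by rw [star_dens, dens_spinZ]
  have hc : ∀ c : ℝ, star (cst c) = cst c := fun c => by
    rw [star_cst]; exact congrArg cst (Complex.conj_ofReal c)
  have h5 : dens (P.nonlin u) w = ∑ l, star (P.nonlin u l) * w l := rfl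
  rw [h5]
  simp only [Params.nonlin, star_add, star_mul', h1, h2, h3, h4, hc]
  generalize dens u (spinX u) = a
  generalize dens u (spinY u) = b
  generalize dens u (spinZ u) = c
  generalize dens u u = d
  simp only [dens, Fin.sum_univ_five]
  ring

lemma dens_nonlin_right (P : Params) (u w : SpinorFamily) : dens w (P.nonlin u) =
    cst P.c₀ * (dens u u * dens w u) + cst P.c₁ * (dens u (spinX u) * dens w (spinX u)
      + dens u (spinY u) * dens w (spinY u) + dens u (spinZ u) * dens w (spinZ u))
      + cst P.c₂ * (singlet u * dens w (pairing u)) := by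
  have h5 : dens w (P.nonlin u) = ∑ l, star (w l) * P.nonlin u l := rfl
  rw [h5]
  simp only [Params.nonlin]
  generalize dens u (spinX u) = a
  generalize dens u (spinY u) = b
  generalize dens u (spinZ u) = c
  generalize dens u u = d
  simp only [dens, Fin.sum_univ_five]
  ring

/-- The nonlinearity is the gradient of the interaction energy. A single computation from the
abstract rules covers the time derivative and both space derivatives. -/
lemma DerivRules.interaction (hD : DerivRules D) (P : Params) (hu : ∀ l, D (u l) (w l)) :
    D (P.interaction u) (P.dInteraction u w) := by
  have h0 := hD.dens hu hu
  have hx := hD.dens hu (hD.spinX hu)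
  have hy := hD.dens hu (hD.spinY hu)
  have hz := hD.dens hu (hD.spinZ hu)
  have hs := hD.singlet hu
  have h := hD.add (hD.add (hD.cst_mul (P.c₀ / 2) (hD.mul h0 h0)) (hD.cst_mul (P.c₁ / 2)
    (hD.add (hD.add (hD.mul hx hx) (hD.mul hy hy)) (hD.mul hz hz))))
    (hD.cst_mul (P.c₂ / 2) (hD.mul (hD.star hs) hs))
  convert h using 1
  · rfl
  rw [Params.dInteraction, dens_nonlin_left, dens_nonlin_right, ← dens_spinX u w,
    ← dens_spinY u w, ← dens_spinZ u w]
  have e : Star.star (cst 2 * SpinTwoBEC.dens (pairing u) w) =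
      cst 2 * SpinTwoBEC.dens w (pairing u) := by
    rw [star_mul', star_dens, star_cst, show Star.star (2 : ℂ) = 2 from map_ofNat (starRingEnd ℂ) 2]
  rw [e]
  funext t p
  simp
  ring

end DerivRules

lemma pd_interaction (P : Params) {u : SpinorFamily} (hu : NiceSpinor u) (a : Fin 2) :
    pd a (P.interaction u) = P.dInteraction u (lift (pd a) u) :=
  ((derivRules_space a).interaction P (w := lift (pd a) u) fun l => ⟨(hu l).1, rfl⟩).2

lemma singlet_eq (u : SpinorFamily) : dens (pairing u) u = singlet u := by
  funext t p
  simp [dens, pairing, singlet, scale, Fin.sum_univ_five]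
  ring

/-- Euler's identity for the quartic interaction energy. -/
lemma dInteraction_self (P : Params) (u : SpinorFamily) :
    P.dInteraction u u = cst 4 * P.interaction u := by
  have h : dens u (pairing u) = star (singlet u) := by rw [← star_dens, singlet_eq]
  rw [Params.dInteraction, dens_nonlin_left, dens_nonlin_right, dens_spinX, dens_spinY,
    dens_spinZ, h, singlet_eq, Params.interaction]
  funext t p
  simp
  ring

lemma dInteraction_add (P : Params) (u v w : SpinorFamily) :
    P.dInteraction u (v + w) = P.dInteraction u v + P.dInteraction u w := by
  simp only [Params.dInteraction, dens_add_left, dens_add_right]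
  ring

lemma dInteraction_scale_real (P : Params) (u w : SpinorFamily) (c : ℝ) :
    P.dInteraction u (scale c w) = cst c * P.dInteraction u w := by
  have : star (c : ℂ) = c := Complex.conj_ofReal c
  simp only [Params.dInteraction, dens_scale_left, dens_scale_right, this]
  ring

lemma dInteraction_coord_mul (P : Params) (u w : SpinorFamily) (a : Fin 2) :
    P.dInteraction u (fun l => coord a * w l) = coord a * P.dInteraction u w := by
  have h : star (coord a) = coord a := by funext t p; simp
  have e1 : dens (P.nonlin u) (fun l => coord a * w l) = coord a * dens (P.nonlin u) w := by
    simp only [dens, Fin.sum_univ_five]; ring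
  have e2 : dens (fun l => coord a * w l) (P.nonlin u) = coord a * dens w (P.nonlin u) := by
    simp only [dens, Fin.sum_univ_five, star_mul', h]; ring
  rw [Params.dInteraction, e1, e2, Params.dInteraction]
  ring

/-- Gauge invariance of the interaction. -/
lemma dInteraction_I (P : Params) (u : SpinorFamily) :
    P.dInteraction u (scale Complex.I u) = 0 := by
  have hI : star Complex.I = -Complex.I := Complex.conj_I
  have h : dens u (pairing u) = star (singlet u) := by rw [← star_dens, singlet_eq]
  rw [Params.dInteraction, dens_scale_left, dens_scale_right, hI, dens_nonlin_left,
    dens_nonlin_right, dens_spinX, dens_spinY, dens_spinZ, h, singlet_eq]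
  funext t p
  simp
  ring

lemma spinY_spinZ (u : SpinorFamily) :
    spinY (spinZ u) = spinZ (spinY u) + scale Complex.I (spinX u) := by
  funext l t p
  fin_cases l <;> simp [spinX, spinY, spinZ, scale] <;> ring

lemma spinZ_spinX (u : SpinorFamily) :
    spinZ (spinX u) = spinX (spinZ u) + scale Complex.I (spinY u) := by
  funext l t p
  fin_cases l <;> simp [spinX, spinY, spinZ, scale]
  · linear_combination (u 1 t p) * Complex.I_sq
  · linear_combination (-u 0 t p + halfSqrt6 * u 2 t p) * Complex.I_sq
  · linear_combination (-halfSqrt6 * u 1 t p + halfSqrt6 * u 3 t p) * Complex.I_sq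
  · linear_combination (-halfSqrt6 * u 2 t p + u 4 t p) * Complex.I_sq
  · linear_combination (-u 3 t p) * Complex.I_sq

/-- `A f_x` is antisymmetric, so its quadratic form vanishes: the singlet amplitude is invariant
under spin rotations. The same holds for `A f_y`. -/
lemma dens_pairing_spinX (u : SpinorFamily) : dens (pairing u) (spinX u) = 0 := by
  funext t p
  simp [dens, pairing, spinX, scale, Fin.sum_univ_five]
  ring

lemma dens_pairing_spinY (u : SpinorFamily) : dens (pairing u) (spinY u) = 0 := by
  funext t p
  simp [dens, pairing, spinY, scale, Fin.sum_univ_five]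
  ring

/-- Rotational invariance of the interaction about the first spin axis. -/
lemma dInteraction_spinX (P : Params) (u : SpinorFamily) :
    P.dInteraction u (scale Complex.I (spinX u)) = 0 := by
  have hI : star Complex.I = -Complex.I := Complex.conj_I
  have h := dens_pairing_spinX u
  have h' : dens (spinX u) (pairing u) = 0 := by rw [← star_dens, h, star_zero]
  -- The rotation mixes `F_y` and `F_z`: the two commutators contribute multiples of `F_y F_z` with
  -- opposite signs, which cancel in the derivative of `|F|²`.
  have hy : dens (spinY u) (spinX u) =
      dens (spinX u) (spinY u) - cst Complex.I * dens u (spinZ u) := by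
    rw [dens_spinX, spinX_spinY, dens_add_right, dens_scale_right, dens_spinY]
    ring
  have hz : dens (spinZ u) (spinX u) =
      dens (spinX u) (spinZ u) + cst Complex.I * dens u (spinY u) := by
    rw [dens_spinX, dens_spinZ, spinZ_spinX, dens_add_right, dens_scale_right]
  rw [Params.dInteraction, dens_scale_left, dens_scale_right, hI, dens_nonlin_left,
    dens_nonlin_right, h, h', hy, hz, dens_spinX u u]
  funext t p
  simp
  ring

/-- Rotational invariance of the interaction about the second spin axis. -/
lemma dInteraction_spinY (P : Params) (u : SpinorFamily) :
    P.dInteraction u (scale Complex.I (spinY u)) = 0 := by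
  have hI : star Complex.I = -Complex.I := Complex.conj_I
  have h := dens_pairing_spinY u
  have h' : dens (spinY u) (pairing u) = 0 := by rw [← star_dens, h, star_zero]
  have hx : dens (spinX u) (spinY u) =
      dens (spinY u) (spinX u) + cst Complex.I * dens u (spinZ u) := by
    rw [dens_spinX, spinX_spinY, dens_add_right, dens_scale_right, dens_spinY]
  have hz : dens (spinZ u) (spinY u) =
      dens (spinY u) (spinZ u) - cst Complex.I * dens u (spinX u) := by
    rw [dens_spinY, spinY_spinZ, dens_add_right, dens_scale_right, dens_spinZ]
    ring
  rw [Params.dInteraction, dens_scale_left, dens_scale_right, hI, dens_nonlin_left,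
    dens_nonlin_right, h, h', hx, hz, dens_spinY u u]
  funext t p
  simp
  ring

/-- Dilation behaviour of the interaction energy. -/
lemma eqDiv_dInteraction_dilation (P : Params) {u : SpinorFamily} (hu : NiceSpinor u) :
    EqDiv (P.dInteraction u (lift dilation u)) (cst 2 * P.interaction u) := by
  have hW := Nice.interaction hu P
  have e : lift dilation u = ((fun l => coord 0 * lift (pd 0) u l) +
      fun l => coord 1 * lift (pd 1) u l) + u := rfl
  refine EqDiv.intro (coord 0 * P.interaction u) (coord 1 * P.interaction u)
    (hW.coord_mul 0) (hW.coord_mul 1) ?_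
  -- The transport terms give `x·∇W` and Euler's identity gives `4W`. The divergence of `(x, y)W`
  -- absorbs `2W`, because the dimension is 2, and `2W` remains.
  rw [e, dInteraction_add, dInteraction_add, dInteraction_coord_mul, dInteraction_coord_mul,
    dInteraction_self, ← pd_interaction P hu, ← pd_interaction P hu,
    pd_mul (sliceSmooth_coord 0) hW.1, pd_mul (sliceSmooth_coord 1) hW.1, pd_zero_coord_zero,
    pd_one_coord_one]
  funext t p
  simp
  ring

/-- Rotational invariance of the interaction energy in the plane. -/
lemma eqDiv_dInteraction_angular (P : Params) {u : SpinorFamily} (hu : NiceSpinor u) :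
    EqDiv (P.dInteraction u (scale Complex.I (lift angular u))) 0 := by
  have hW := Nice.interaction hu P
  have e : scale Complex.I (lift angular u) = (fun l => coord 0 * lift (pd 1) u l) +
      scale ((-1 : ℝ) : ℂ) (fun l => coord 1 * lift (pd 0) u l) := by
    funext l t p
    simp [scale, lift, angular]
    linear_combination (-((p 0 : ℂ) * pd 1 (u l) t p - (p 1 : ℂ) * pd 0 (u l) t p)) *
      Complex.I_sq
  refine EqDiv.intro (cst (-1) * (coord 1 * P.interaction u)) (coord 0 * P.interaction u)
    ((hW.coord_mul 1).cst_mul _) (hW.coord_mul 0) ?_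
  rw [e, dInteraction_add, dInteraction_scale_real, dInteraction_coord_mul,
    dInteraction_coord_mul, ← pd_interaction P hu, ← pd_interaction P hu]
  have h := hW.1
  funext t p
  simp (maxDischargeDepth := 20) [h]
  ring

/-- The interaction is invariant under position-dependent spin rotations. -/
lemma dInteraction_spinMoment (P : Params) (u : SpinorFamily) :
    P.dInteraction u (scale Complex.I (spinMoment u)) = 0 := by
  have e : scale Complex.I (spinMoment u) = (fun l => coord 1 * scale Complex.I (spinX u) l) +
      scale ((-1 : ℝ) : ℂ) (fun l => coord 0 * scale Complex.I (spinY u) l) := by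
    funext l t p
    simp [scale, spinMoment]
    ring
  rw [e, dInteraction_add, dInteraction_scale_real, dInteraction_coord_mul,
    dInteraction_coord_mul, dInteraction_spinX, dInteraction_spinY]
  simp

/-- The interaction is unaffected by position-dependent phases. -/
lemma dInteraction_radiusSq (P : Params) (u : SpinorFamily) :
    P.dInteraction u (scale Complex.I (lift radiusSq u)) = 0 := by
  have e : scale Complex.I (lift radiusSq u) =
      (fun l => coord 0 * (fun l => coord 0 * scale Complex.I u l) l) +
        fun l => coord 1 * (fun l => coord 1 * scale Complex.I u l) l := by
    funext l t p
    simp [scale, lift, radiusSq]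
    ring
  rw [e, dInteraction_add]
  simp only [dInteraction_coord_mul, dInteraction_I]
  simp

/-! ### Evolution of expectation values -/

/-- The linear part of the Hamiltonian for the radially symmetric trap of frequency `γr`. -/
def Params.ham (P : Params) (γr : ℝ) (u : SpinorFamily) : SpinorFamily :=
  lift kinetic u + scale ((γr ^ 2 / 2 : ℝ) : ℂ) (lift radiusSq u)
    + scale ((-P.Ω : ℝ) : ℂ) (lift angular u) + scale (P.γ : ℂ) (spinOrbit u)

lemma linearOp_ham (P : Params) (γr : ℝ) : LinearOp (P.ham γr) :=
  ((linearOp_kinetic.addOp (linearOp_radiusSq.scaleOp _)).addOp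
    (linearOp_angular.scaleOp _)).addOp (linearOp_spinOrbit.scaleOp _)

lemma symmOp_ham (P : Params) (γr : ℝ) : SymmOp (P.ham γr) :=
  ((symmOp_kinetic.addOp (symmOp_radiusSq.scaleOp _)).addOp
    (symmOp_angular.scaleOp _)).addOp (symmOp_spinOrbit.scaleOp _)

lemma linearOp_apply_ham {O : SpinorFamily → SpinorFamily} (hO : LinearOp O) (P : Params) (γr : ℝ)
    {u : SpinorFamily} (hu : NiceSpinor u) : O (P.ham γr u) =
      O (lift kinetic u) + scale ((γr ^ 2 / 2 : ℝ) : ℂ) (O (lift radiusSq u))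
        + scale ((-P.Ω : ℝ) : ℂ) (O (lift angular u)) + scale (P.γ : ℂ) (O (spinOrbit u)) := by
  have h1 := linearOp_kinetic.nice hu
  have h2 := linearOp_radiusSq.nice hu
  have h3 := linearOp_angular.nice hu
  have h4 := linearOp_spinOrbit.nice hu
  rw [Params.ham, hO.add ((h1.add (h2.scale _)).add (h3.scale _)) (h4.scale _),
    hO.add (h1.add (h2.scale _)) (h3.scale _), hO.add h1 (h2.scale _), hO.scale _ h2,
    hO.scale _ h3, hO.scale _ h4]

/-- The time derivative prescribed by the Gross-Pitaevskii equations. -/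
def Params.velocity (P : Params) (γr : ℝ) (u : SpinorFamily) : SpinorFamily :=
  scale (-Complex.I) (P.ham γr u + P.nonlin u)

/-- Solutions of the Gross-Pitaevskii equations for the radially symmetric trap. -/
structure Params.Evolves (P : Params) (γr : ℝ) (u : SpinorFamily) : Prop where
  joint : ∀ l, JointSmooth (u l)
  deriv : ∀ l, TimeDeriv (u l) (P.velocity γr u l)

/-- The integrals of `f` have the integrals of `g` as time derivatives. -/
def WeakDeriv (f g : Family) : Prop := ∃ f', TimeDeriv f f' ∧ EqDiv f' g

namespace WeakDeriv

lemma add {f g f' g' : Family} (h : WeakDeriv f g) (h' : WeakDeriv f' g') :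
    WeakDeriv (f + f') (g + g') := by
  obtain ⟨k, hk, e⟩ := h
  obtain ⟨k', hk', e'⟩ := h'
  exact ⟨_, hk.add hk', e.add e'⟩

lemma cst_mul {f g : Family} (h : WeakDeriv f g) (c : ℂ) : WeakDeriv (cst c * f) (cst c * g) := by
  obtain ⟨k, hk, e⟩ := h
  exact ⟨_, hk.cst_mul c, e.cst_mul c⟩

lemma trans {f g k : Family} (h : WeakDeriv f g) (h' : EqDiv g k) : WeakDeriv f k := by
  obtain ⟨m, hm, e⟩ := h
  exact ⟨m, hm, e.trans h'⟩

lemma integral {f g : Family} (h : WeakDeriv f g) (hg : Nice g) (t : ℝ≥0) :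
    HasDerivWithinAt (fun τ : ℝ => ∫ p, f τ.toNNReal p) (∫ p, g t p) (Set.Ici 0) t := by
  obtain ⟨m, hm, e⟩ := h
  rw [← e.integral_eq hg]
  exact hm.integral t

end WeakDeriv

namespace Params.Evolves

variable {P : Params} {γr : ℝ} {u : SpinorFamily}

lemma nice (h : P.Evolves γr u) : NiceSpinor u := fun l => (h.deriv l).nice

lemma nice_velocity (h : P.Evolves γr u) : NiceSpinor (P.velocity γr u) :=
  fun l => (h.deriv l).nice_deriv

/-- Ehrenfest's theorem. -/
lemma weakDeriv (h : P.Evolves γr u) {O : SpinorFamily → SpinorFamily} (hO : LinearOp O)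
    (hS : SymmOp O) (hT : ∀ l, TimeDeriv (O u l) (O (P.velocity γr u) l)) {C : SpinorFamily}
    (hC : P.ham γr (O u) = O (P.ham γr u) + C) :
    WeakDeriv (dens u (O u))
      (cst Complex.I * dens u C + P.dInteraction u (scale Complex.I (O u))) := by
  have hu := h.nice
  have hv := h.nice_velocity
  have hH := (linearOp_ham P γr).nice hu
  refine ⟨_, derivRules_time.dens h.deriv hT, ?_⟩
  -- Moving `O` off the velocity lets the nonlinear part of the velocity pair directly with `O u`,
  -- which forms `dInteraction`; the Hamiltonian part becomes the commutator.
  have e1 : EqDiv (dens u (O (P.velocity γr u))) (dens (O u) (P.velocity γr u)) :=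
    (hS u _ hu hv).symm
  have e2 : EqDiv (dens (P.ham γr u) (O u)) (dens u (P.ham γr (O u))) :=
    symmOp_ham P γr u _ hu (hO.nice hu)
  have e3 : EqDiv (dens (O u) (P.ham γr u)) (dens u (O (P.ham γr u))) :=
    hS u _ hu hH
  refine ((EqDiv.refl _).add e1).trans ?_
  have e4 := ((e2.cst_mul Complex.I).add (e3.cst_mul (-Complex.I))).add
    (EqDiv.refl (P.dInteraction u (scale Complex.I (O u))))
  have hI : star Complex.I = -Complex.I := Complex.conj_I
  convert e4 using 1
  · simp only [Params.velocity, Params.dInteraction, dens_scale_left, dens_scale_right,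
      dens_add_left, dens_add_right, star_neg, hI, neg_neg]
    ring
  · rw [hC, dens_add_right]
    funext t p
    simp
    ring

end Params.Evolves

/-- Multiplication by `x f_x + y f_y`. -/
def spinRadial (u : SpinorFamily) : SpinorFamily :=
  fun l => coord 0 * spinX u l + coord 1 * spinY u l

/-- Only the kinetic and spin-orbit terms contribute, since `r²` commutes with multiplications and
is rotation invariant. -/
lemma ham_radiusSq (P : Params) (γr : ℝ) {u : SpinorFamily} (hu : NiceSpinor u) :
    P.ham γr (lift radiusSq u) = lift radiusSq (P.ham γr u) +
      (scale (-2 * Complex.I) (lift symmDilation u) +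
        scale (-2 * Complex.I * P.γ) (spinMoment u)) := by
  rw [linearOp_apply_ham linearOp_radiusSq P γr hu, Params.ham, spinOrbit_radiusSq hu]
  funext l
  simp only [Pi.add_apply (ι := Fin 5), lift, scale, kinetic_radiusSq (hu l),
    angular_radiusSq (hu l)]
  funext t p
  simp [symmDilation]
  linear_combination (-2 * dilation (u l) t p) * Complex.I_sq

/-- Each term of the Hamiltonian is weighted by minus its degree of homogeneity. -/
lemma ham_symmDilation (P : Params) (γr : ℝ) {u : SpinorFamily} (hu : NiceSpinor u) :
    P.ham γr (lift symmDilation u) = lift symmDilation (P.ham γr u) +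
      scale (-Complex.I) (scale 2 (lift kinetic u) +
        scale (((-γr ^ 2 : ℝ)) : ℂ) (lift radiusSq u) + scale (P.γ : ℂ) (spinOrbit u)) := by
  have hd : NiceSpinor (lift dilation u) := fun l => (hu l).dilation
  have e : lift symmDilation u = scale (-Complex.I) (lift dilation u) := rfl
  have e' : lift symmDilation (spinOrbit u) =
    scale (-Complex.I) (lift dilation (spinOrbit u)) := rfl
  rw [linearOp_apply_ham linearOp_symmDilation P γr hu, e,
    (linearOp_ham P γr).scale _ hd, Params.ham,
    spinOrbit_dilation hu, e']
  funext l
  simp only [Pi.add_apply (ι := Fin 5), lift, scale, kinetic_dilation (hu l),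
    angular_dilation (hu l), radiusSq_dilation (hu l), symmDilation]
  funext t p
  simp
  ring

lemma ham_spinMoment (P : Params) (γr : ℝ) {u : SpinorFamily} (hu : NiceSpinor u) :
    P.ham γr (spinMoment u) = spinMoment (P.ham γr u) +
      scale (-Complex.I) (spinOrbit u + scale ((-P.Ω : ℝ) : ℂ) (spinRadial u) +
        scale (P.γ : ℂ) (spinX (spinX u) + spinY (spinY u) + lift angular (spinZ u))) := by
  rw [linearOp_apply_ham linearOp_spinMoment P γr hu, Params.ham, spinOrbit_spinMoment hu,
    kinetic_spinMoment hu, radiusSq_spinMoment u, angular_spinMoment hu]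
  funext l
  simp only [Pi.add_apply (ι := Fin 5), scale, spinRadial]
  ring

/-- The terms left at `γ = 0` are scalar and rotation invariant; the spin-orbit term, which ties
spatial directions to spin directions, is absent. -/
lemma ham_angular (P : Params) (γr : ℝ) (hγ : P.γ = 0) {u : SpinorFamily} (hu : NiceSpinor u) :
    P.ham γr (lift angular u) = lift angular (P.ham γr u) + 0 := by
  rw [linearOp_apply_ham linearOp_angular P γr hu, Params.ham, hγ]
  funext l
  simp only [Pi.add_apply (ι := Fin 5), lift, scale, kinetic_angular (hu l),
    ← angular_radiusSq (hu l)]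
  funext t p
  simp

namespace Params.Evolves

variable {P : Params} {γr : ℝ} {u : SpinorFamily}

lemma timeDeriv_pd (h : P.Evolves γr u) (a : Fin 2) (l : Fin 5) :
    TimeDeriv (pd a (u l)) (pd a (P.velocity γr u l)) :=
  TimeDeriv.pd (h.joint l) (h.deriv l) a

lemma timeDeriv_kinetic (h : P.Evolves γr u) (l : Fin 5) :
    TimeDeriv (kinetic (u l)) (kinetic (P.velocity γr u l)) :=
  ((TimeDeriv.pd ((h.joint l).pd 0) (h.timeDeriv_pd 0 l) 0).add
    (TimeDeriv.pd ((h.joint l).pd 1) (h.timeDeriv_pd 1 l) 1)).cst_mul _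

lemma timeDeriv_radiusSq (h : P.Evolves γr u) (l : Fin 5) :
    TimeDeriv (radiusSq (u l)) (radiusSq (P.velocity γr u l)) :=
  (((h.deriv l).coord_mul 0).coord_mul 0).add (((h.deriv l).coord_mul 1).coord_mul 1)

lemma timeDeriv_angular (h : P.Evolves γr u) (l : Fin 5) :
    TimeDeriv (angular (u l)) (angular (P.velocity γr u l)) :=
  (((h.timeDeriv_pd 1 l).coord_mul 0).sub ((h.timeDeriv_pd 0 l).coord_mul 1)).cst_mul _

lemma timeDeriv_symmDilation (h : P.Evolves γr u) (l : Fin 5) :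
    TimeDeriv (symmDilation (u l)) (symmDilation (P.velocity γr u l)) :=
  ((((h.timeDeriv_pd 0 l).coord_mul 0).add ((h.timeDeriv_pd 1 l).coord_mul 1)).add
    (h.deriv l)).cst_mul _

lemma timeDeriv_spinMoment (h : P.Evolves γr u) (l : Fin 5) :
    TimeDeriv (spinMoment u l) (spinMoment (P.velocity γr u) l) :=
  ((derivRules_time.spinX h.deriv l).coord_mul 1).sub
    ((derivRules_time.spinY h.deriv l).coord_mul 0)

lemma timeDeriv_spinOrbit (h : P.Evolves γr u) (l : Fin 5) :
    TimeDeriv (spinOrbit u l) (spinOrbit (P.velocity γr u) l) :=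
  ((derivRules_time.spinX (h.timeDeriv_pd 1) l).sub
    (derivRules_time.spinY (h.timeDeriv_pd 0) l)).cst_mul _

lemma timeDeriv_ham (h : P.Evolves γr u) (l : Fin 5) :
    TimeDeriv (P.ham γr u l) (P.ham γr (P.velocity γr u) l) :=
  (((h.timeDeriv_kinetic l).add ((h.timeDeriv_radiusSq l).cst_mul _)).add
    ((h.timeDeriv_angular l).cst_mul _)).add ((h.timeDeriv_spinOrbit l).cst_mul _)

lemma weakDeriv_radiusSq (h : P.Evolves γr u) : WeakDeriv (dens u (lift radiusSq u))
    (cst 2 * dens u (lift symmDilation u) + cst (2 * P.γ) * dens u (spinMoment u)) := by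
  have := h.weakDeriv linearOp_radiusSq symmOp_radiusSq h.timeDeriv_radiusSq
    (ham_radiusSq P γr h.nice)
  convert this using 1
  rw [dInteraction_radiusSq, dens_add_right, dens_scale_right, dens_scale_right]
  funext t p
  simp
  linear_combination (2 * dens u (lift symmDilation u) t p +
    2 * P.γ * dens u (spinMoment u) t p) * Complex.I_sq

lemma weakDeriv_symmDilation (h : P.Evolves γr u) : WeakDeriv (dens u (lift symmDilation u))
    (cst 2 * dens u (lift kinetic u) + cst ((-γr ^ 2 : ℝ) : ℂ) * dens u (lift radiusSq u) +
      cst P.γ * dens u (spinOrbit u) + cst 2 * P.interaction u) := by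
  have := h.weakDeriv linearOp_symmDilation symmOp_symmDilation h.timeDeriv_symmDilation
    (ham_symmDilation P γr h.nice)
  -- The direction in which the interaction is differentiated is thus the real dilation field, where
  -- its scaling law applies.
  have e : scale Complex.I (lift symmDilation u) = lift dilation u := by
    funext l t p
    simp [scale, lift, symmDilation]
    linear_combination (-dilation (u l) t p) * Complex.I_sq
  rw [e] at this
  refine this.trans ?_
  refine (EqDiv.of_eq ?_).add (eqDiv_dInteraction_dilation P h.nice)
  simp only [dens_add_right, dens_scale_right]
  funext t p
  simp
  linear_combination (-(2 * dens u (lift kinetic u) t p - γr ^ 2 * dens u (lift radiusSq u) t p +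
    P.γ * dens u (spinOrbit u) t p)) * Complex.I_sq

lemma weakDeriv_spinMoment (h : P.Evolves γr u) : WeakDeriv (dens u (spinMoment u))
    (dens u (spinOrbit u) + cst ((-P.Ω : ℝ) : ℂ) * dens u (spinRadial u) +
      cst P.γ * dens u (spinX (spinX u) + spinY (spinY u) + lift angular (spinZ u))) := by
  have := h.weakDeriv linearOp_spinMoment symmOp_spinMoment h.timeDeriv_spinMoment
    (ham_spinMoment P γr h.nice)
  convert this using 1
  simp only [dInteraction_spinMoment, dens_scale_right, dens_add_right]
  funext t p
  simp
  linear_combination (dens u (spinOrbit u) t p - P.Ω * dens u (spinRadial u) t p + P.γ *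
    (dens u (spinX (spinX u)) t p + dens u (spinY (spinY u)) t p +
      dens u (lift angular (spinZ u)) t p)) * Complex.I_sq

/-- Conservation of angular momentum. -/
lemma weakDeriv_angular (h : P.Evolves γr u) (hγ : P.γ = 0) :
    WeakDeriv (dens u (lift angular u)) 0 := by
  have := h.weakDeriv linearOp_angular symmOp_angular h.timeDeriv_angular
    (ham_angular P γr hγ h.nice)
  refine this.trans (EqDiv.trans ((EqDiv.of_eq (g := 0) ?_).add
    (eqDiv_dInteraction_angular P h.nice)) (EqDiv.of_eq (add_zero 0)))
  simp [dens]

/-- Conservation of energy. -/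
lemma weakDeriv_energy (h : P.Evolves γr u) :
    WeakDeriv (dens u (P.ham γr u) + P.interaction u) 0 := by
  have h1 := h.weakDeriv (linearOp_ham P γr) (symmOp_ham P γr) h.timeDeriv_ham
    (C := 0) (add_zero _).symm
  have h2 : WeakDeriv (P.interaction u) (P.dInteraction u (P.velocity γr u)) :=
    ⟨_, derivRules_time.interaction P h.deriv, EqDiv.refl _⟩
  -- The contribution of `iHu` from Ehrenfest's theorem cancels the Hamiltonian part of the
  -- velocity. What is left is the interaction derivative along `-iN`, zero because `N` pairs with
  -- itself to a real density.
  refine (h1.add h2).trans (EqDiv.of_eq ?_)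
  have hI : star Complex.I = -Complex.I := Complex.conj_I
  simp only [Params.dInteraction, Params.velocity, dens_scale_left, dens_scale_right,
    dens_add_left, dens_add_right, star_neg, hI, neg_neg]
  funext t p
  simp [dens]
  ring

end Params.Evolves

/-! ### Solutions as families -/

/-- The components of a time-dependent spinor field. -/
def components (Ψ : ℝ → Plane → Spinor) : SpinorFamily := fun l t p => Ψ t p l

/-- A partial derivative is the Fréchet derivative evaluated at a unit vector, so its bounds of
order `m` are those of `f` of order `m + 1`, with the same constant. -/
lemma rapidDecayOrder_of_iteratedFDeriv (n : ℕ) : ∀ {f : Family}, SliceSmooth f →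
    (∀ T : ℝ≥0, ∀ k m : ℕ, ∃ C : ℝ, ∀ t ≤ T, ∀ p : Plane,
      ‖p‖ ^ k * ‖iteratedFDeriv ℝ m (f t) p‖ ≤ C) → RapidDecayOrder n f := by
  induction n with
  | zero =>
    intro f _ h T k
    obtain ⟨C, hC⟩ := h T k 0
    exact ⟨C, fun t ht p => by simpa using hC t ht p⟩
  | succ n ih =>
    intro f hf h
    refine ⟨fun T k => ?_, fun a => ih (hf.pd a) fun T k m => ?_⟩
    · obtain ⟨C, hC⟩ := h T k 0
      exact ⟨C, fun t ht p => by simpa using hC t ht p⟩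
    · obtain ⟨C, hC⟩ := h T k (m + 1)
      refine ⟨C, fun t ht p => le_trans ?_ (hC t ht p)⟩
      gcongr
      have h1 : ContDiffAt ℝ m (fderiv ℝ (f t)) p :=
        (contDiff_infty.1 ((hf t).fderiv_right (m := ∞) (by simp)) m).contDiffAt
      have h2 := norm_iteratedFDeriv_clm_apply_const (c := EuclideanSpace.single a (1 : ℝ)) h1
        le_rfl
      rw [norm_iteratedFDeriv_fderiv] at h2
      simp only [PiLp.norm_single, norm_one, one_mul] at h2
      exact h2

namespace Params.IsSolution

variable {P : Params} {Ψ : ℝ → Plane → Spinor}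

lemma jointSmooth (hΨ : P.IsSolution Ψ) (l : Fin 5) : JointSmooth (components Ψ l) := by
  have h := contDiffOn_pi.1 hΨ.smooth l
  refine h.congr fun q hq => ?_
  simp only [components]
  rw [Real.coe_toNNReal _ hq.1]

lemma contDiff_slice (hΨ : P.IsSolution Ψ) (t : ℝ≥0) : ContDiff ℝ ∞ (Ψ t) := by
  have h : ContDiffOn ℝ ∞ (fun p : Plane => ((t : ℝ), p)) Set.univ :=
    (contDiff_const.prodMk contDiff_id).contDiffOn
  exact contDiffOn_univ.1 (hΨ.smooth.comp h fun p _ => ⟨t.2, trivial⟩)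

lemma niceSpinor (hΨ : P.IsSolution Ψ) : NiceSpinor (components Ψ) := by
  intro l
  have hs : SliceSmooth (components Ψ l) := fun t => contDiff_pi.1 (hΨ.contDiff_slice t) l
  refine ⟨hs, fun n => rapidDecayOrder_of_iteratedFDeriv n hs fun T k m => ?_⟩
  obtain ⟨C, hC⟩ := hΨ.decay T k m
  refine ⟨C, fun t ht p => le_trans ?_ (hC t ⟨t.2, by exact_mod_cast ht⟩ p)⟩
  gcongr
  have h := ContinuousLinearMap.norm_iteratedFDeriv_comp_left
    (ContinuousLinearMap.proj (R := ℝ) (φ := fun _ : Fin 5 => ℂ) l)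
    (contDiff_infty.1 (hΨ.contDiff_slice t) m).contDiffAt (x := p) (n := m) le_rfl
  refine h.trans ((mul_le_mul_of_nonneg_right ?_ (norm_nonneg _)).trans (one_mul _).le)
  refine ContinuousLinearMap.opNorm_le_bound _ zero_le_one fun v => ?_
  simpa using norm_le_pi_norm v l

end Params.IsSolution

/-! ### The given pointwise expressions in terms of operators on families -/

section Pointwise

variable (Ψ : ℝ → Plane → Spinor) (t : ℝ≥0) (p : Plane)

lemma rho_eq : (rho (Ψ t p) : ℂ) = dens (components Ψ) (components Ψ) t p := by
  simp [rho, dens, components, Complex.conj_mul']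

lemma Fx_eq : Fx (Ψ t p) = dens (components Ψ) (spinX (components Ψ)) t p := by
  simp [Fx, fx, dens, components, spinX, Fin.sum_univ_five, dotProduct, Matrix.mulVec]

lemma Fy_eq : Fy (Ψ t p) = dens (components Ψ) (spinY (components Ψ)) t p := by
  simp [Fy, fy, dens, components, spinY, Fin.sum_univ_five, dotProduct, Matrix.mulVec]
  ring

lemma Fz_eq : Fz (Ψ t p) = dens (components Ψ) (spinZ (components Ψ)) t p := by
  simp [Fz, fz, dens, components, spinZ, Fin.sum_univ_five, dotProduct, Matrix.mulVec]

lemma A00_eq : A00 (Ψ t p) = singlet (components Ψ) t p := by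
  simp [A00, A, singlet, components, Fin.sum_univ_five, dotProduct, Matrix.mulVec]
  ring

lemma pairing_eq (l : Fin 5) : (A *ᵥ star (Ψ t p)) l = pairing (components Ψ) l t p := by
  fin_cases l <;>
    simp [A, pairing, scale, components, Fin.sum_univ_five, dotProduct, Matrix.mulVec]

lemma Fdotf_eq (l : Fin 5) : (Fdotf (Ψ t p) *ᵥ Ψ t p) l =
    Fx (Ψ t p) * spinX (components Ψ) l t p + Fy (Ψ t p) * spinY (components Ψ) l t p +
      Fz (Ψ t p) * spinZ (components Ψ) l t p := by
  generalize ha : Fx (Ψ t p) = a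
  generalize hb : Fy (Ψ t p) = b
  generalize hc : Fz (Ψ t p) = c
  simp only [Fdotf, ha, hb, hc, Matrix.add_mulVec, Matrix.smul_mulVec]
  fin_cases l <;>
    simp [fx, fy, fz, spinX, spinY, spinZ, components, Fin.sum_univ_five, dotProduct] <;>
    first | ring1 | exact Or.inl (by ring1)

lemma Lz_eq (l : Fin 5) : Lz (comp (Ψ t) l) p = angular (components Ψ l) t p := rfl

lemma soc_eq (l : Fin 5) : soc (Ψ t) p l = -spinOrbit (components Ψ) l t p := by
  have hd : ∀ l, dX (comp (Ψ t) l) p = pd 0 (components Ψ l) t p := fun _ => rfl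
  have hd' : ∀ l, dY (comp (Ψ t) l) p = pd 1 (components Ψ l) t p := fun _ => rfl
  fin_cases l <;>
    simp [soc, Lplus, Lminus, hd, hd', spinOrbit, spinX, spinY, lift]
  · linear_combination (-pd 0 (components Ψ 1) t p) * Complex.I_sq
  · linear_combination (pd 0 (components Ψ 0) t p -
      halfSqrt6 * pd 0 (components Ψ 2) t p) * Complex.I_sq
  · linear_combination (halfSqrt6 * pd 0 (components Ψ 1) t p -
      halfSqrt6 * pd 0 (components Ψ 3) t p) * Complex.I_sq
  · linear_combination (halfSqrt6 * pd 0 (components Ψ 2) t p -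
      pd 0 (components Ψ 4) t p) * Complex.I_sq
  · linear_combination (pd 0 (components Ψ 3) t p) * Complex.I_sq

lemma laplacian_eq {f : Family} (hf : SliceSmooth f) :
    -(1 / 2) * Laplacian.laplacian (f t) p = kinetic f t p := by
  have key : ∀ a, iteratedFDeriv ℝ 2 (f t) p
      ![EuclideanSpace.basisFun (Fin 2) ℝ a, EuclideanSpace.basisFun (Fin 2) ℝ a] =
      pd a (pd a f) t p := by
    intro a
    have hd : DifferentiableAt ℝ (fderiv ℝ (f t)) p :=
      ((hf t).fderiv_right (m := ∞) (by simp)).differentiable (by simp) p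
    rw [iteratedFDeriv_two_apply]
    change _ = fderiv ℝ (fun q => fderiv ℝ (f t) q (EuclideanSpace.single a 1)) p _
    rw [fderiv_clm_apply hd (differentiableAt_const _)]
    simp
  rw [InnerProductSpace.laplacian_eq_iteratedFDeriv_orthonormalBasis (f t)
    (EuclideanSpace.basisFun (Fin 2) ℝ)]
  simp only [key, Fin.sum_univ_two, kinetic]
  simp

end Pointwise

/-- No decay of the time derivative is assumed. The equation expresses it through space derivatives,
coordinate multiples and products of rapidly decreasing functions, which supplies the decay. -/
lemma Params.IsSolution.evolves {P : Params} {γr : ℝ} (hx : P.γx = γr) (hy : P.γy = γr)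
    {Ψ : ℝ → Plane → Spinor} (hΨ : P.IsSolution Ψ) : P.Evolves γr (components Ψ) := by
  have hn := hΨ.niceSpinor
  have hrhs : ∀ (l : Fin 5) (t : ℝ≥0) (p : Plane),
      P.rhs (Ψ t) l p = (P.ham γr (components Ψ) + P.nonlin (components Ψ)) l t p := by
    intro l t p
    have hk : -(1 / 2) * Laplacian.laplacian (comp (Ψ t) l) p = kinetic (components Ψ l) t p := by
      have hc : comp (Ψ t) l = components Ψ l t := rfl
      rw [hc]
      exact laplacian_eq t p (hn l).1
    simp only [Params.rhs, Params.H0, hk, Fdotf_eq Ψ t p, Lz_eq Ψ t p, soc_eq Ψ t p, rho_eq Ψ t p,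
      Fx_eq Ψ t p, Fy_eq Ψ t p, Fz_eq Ψ t p, A00_eq Ψ t p, pairing_eq Ψ t p]
    simp [Params.ham, Params.nonlin, lift, scale, radiusSq, Params.V, hx, hy, components]
    ring
  refine ⟨hΨ.jointSmooth, fun l => ⟨hn l, ?_, fun t p => ?_⟩⟩
  · exact ((((linearOp_ham P γr).nice hn).add (hn.nonlin P)).scale _) l
  · have h1 := hasDerivWithinAt_time ((hΨ.jointSmooth l).differentiableWithinAt
      (q := ((t : ℝ), p)) ⟨t.2, trivial⟩)
    set d := fderivWithin ℝ (fun q : ℝ × Plane => components Ψ l q.1.toNNReal q.2)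
      (Set.Ici 0 ×ˢ Set.univ) ((t : ℝ), p) (1, 0) with hd
    have h2 : HasDerivWithinAt (fun τ => Ψ τ p l) d (Set.Ici 0) t :=
      h1.congr (fun τ hτ => by simp [components, Real.coe_toNNReal τ hτ]) (by simp [components])
    have h3 := hΨ.eqn t t.2 p l
    rw [h2.derivWithin (uniqueDiffOn_Ici 0 _ t.2), hrhs] at h3
    have h4 : d = P.velocity γr (components Ψ) l t p := by
      have : P.velocity γr (components Ψ) l t p = -Complex.I *
        (P.ham γr (components Ψ) + P.nonlin (components Ψ)) l t p := rfl
      rw [this, ← h3]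
      linear_combination d * Complex.I_sq
    rw [← h4]
    exact h1

/-! ### Physical quantities as integrals of families -/

/-- The spatial integral. -/
def total (f : Family) (t : ℝ≥0) : ℂ := ∫ p, f t p

lemma total_add {f g : Family} (hf : Nice f) (hg : Nice g) (t : ℝ≥0) :
    total (f + g) t = total f t + total g t :=
  integral_add (hf.integrable t) (hg.integrable t)

lemma total_cst_mul (c : ℂ) (f : Family) (t : ℝ≥0) : total (cst c * f) t = c * total f t :=
  integral_const_mul c _

lemma SymmOp.total_im {O : SpinorFamily → SpinorFamily} (hO : LinearOp O) (hS : SymmOp O)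
    {u : SpinorFamily} (hu : NiceSpinor u) (t : ℝ≥0) : (total (dens u (O u)) t).im = 0 := by
  have h := (hS u u hu hu).integral_eq (Nice.dens hu (hO.nice hu)) t
  rw [← star_dens u (O u)] at h
  rw [← Complex.conj_eq_iff_im, total, ← integral_conj]
  exact h

lemma total_im_of_star_eq {f : Family} (h : star f = f) (t : ℝ≥0) : (total f t).im = 0 := by
  rw [← Complex.conj_eq_iff_im, total, ← integral_conj]
  exact congrArg (fun f : Family => ∫ p, f t p) h

/-- The energy density of a spinor field. -/
def Params.energyFamily (P : Params) (γr : ℝ) (u : SpinorFamily) : Family :=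
  (∑ l, cst (1 / 2) * (star (pd 0 (u l)) * pd 0 (u l) + star (pd 1 (u l)) * pd 1 (u l)))
    + cst ((γr ^ 2 / 2 : ℝ) : ℂ) * dens u (lift radiusSq u)
    + cst ((-P.Ω : ℝ) : ℂ) * dens u (lift angular u) + cst P.γ * dens u (spinOrbit u)
    + P.interaction u

lemma eqDiv_energyFamily (P : Params) (γr : ℝ) {u : SpinorFamily} (hu : NiceSpinor u) :
    EqDiv (P.energyFamily γr u) (dens u (P.ham γr u) + P.interaction u) := by
  have h : EqDiv (∑ l, cst (1 / 2) * (star (pd 0 (u l)) * pd 0 (u l) +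
      star (pd 1 (u l)) * pd 1 (u l))) (dens u (lift kinetic u)) :=
    EqDiv.sum _ fun l => (EqDiv.kinetic_grad (hu l)).symm
  have e : dens u (P.ham γr u) = dens u (lift kinetic u) +
      cst ((γr ^ 2 / 2 : ℝ) : ℂ) * dens u (lift radiusSq u) +
      cst ((-P.Ω : ℝ) : ℂ) * dens u (lift angular u) + cst P.γ * dens u (spinOrbit u) := by
    simp only [Params.ham, dens_add_right, dens_scale_right]
  rw [e]
  exact (((h.add (.refl _)).add (.refl _)).add (.refl _)).add (.refl _)

lemma Nice.energyFamily (P : Params) (γr : ℝ) {u : SpinorFamily} (hu : NiceSpinor u) :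
    Nice (P.energyFamily γr u) :=
  ((((Nice.sum _ fun l => ((((hu l).pd 0).star.mul ((hu l).pd 0)).add
    (((hu l).pd 1).star.mul ((hu l).pd 1))).cst_mul _).add
    ((Nice.dens hu (linearOp_radiusSq.nice hu)).cst_mul _)).add
    ((Nice.dens hu (linearOp_angular.nice hu)).cst_mul _)).add
    ((Nice.dens hu hu.spinOrbit).cst_mul _)).add (Nice.interaction hu P)

lemma star_interaction (P : Params) (u : SpinorFamily) :
    star (P.interaction u) = P.interaction u := by
  have h1 : star (dens u u) = dens u u := star_dens u u
  have h2 : star (dens u (spinX u)) = dens u (spinX u) := by rw [star_dens, dens_spinX]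
  have h3 : star (dens u (spinY u)) = dens u (spinY u) := by rw [star_dens, dens_spinY]
  have h4 : star (dens u (spinZ u)) = dens u (spinZ u) := by rw [star_dens, dens_spinZ]
  have hc : ∀ c : ℝ, star (cst (c / 2)) = cst (c / 2) := fun c => by
    have : star ((c : ℂ) / 2) = (c : ℂ) / 2 := by
      have := Complex.conj_ofReal (c / 2)
      push_cast at this
      exact this
    rw [star_cst, this]
  simp only [Params.interaction, star_add, star_mul', h1, h2, h3, h4, hc, star_star]
  ring

/-! ### Densities of the energy, of the angular momentum and of `G` -/

section Bridge

variable {P : Params} {γr : ℝ} (Ψ : ℝ → Plane → Spinor) (t : ℝ≥0)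

lemma angMomDensity_eq :
    angMomDensity (Ψ t) = dens (components Ψ) (lift angular (components Ψ)) t := by
  funext p
  simp only [angMomDensity, Lz_eq Ψ t p]
  simp [dens, components, lift]

lemma conj_dens_self {O : SpinorFamily → SpinorFamily} {u : SpinorFamily}
    (h : dens (O u) u = dens u (O u)) (p : Plane) :
    (starRingEnd ℂ) (dens u (O u) t p) = dens u (O u) t p := by
  have h2 : star (dens u (O u)) = dens u (O u) := by rw [star_dens, h]
  exact congrFun (congrFun h2 t) p

lemma energyDensity_eq (hx : P.γx = γr) (hy : P.γy = γr) :
    P.energyDensity (Ψ t) = P.energyFamily γr (components Ψ) t := by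
  funext p
  -- The spin components are real, so `|F₊|² = F_x² + F_y²`.
  have hX := conj_dens_self t (dens_spinX (components Ψ) (components Ψ)) p
  have hY := conj_dens_self t (dens_spinY (components Ψ) (components Ψ)) p
  have hZ := conj_dens_self t (dens_spinZ (components Ψ) (components Ψ)) p
  have hd : ∀ l, dX (comp (Ψ t) l) p = pd 0 (components Ψ l) t p := fun _ => rfl
  have hd' : ∀ l, dY (comp (Ψ t) l) p = pd 1 (components Ψ l) t p := fun _ => rfl
  have hψ : ∀ l, Ψ t p l = components Ψ l t p := fun _ => rfl
  simp only [Params.energyDensity, Complex.ofReal_add, Complex.ofReal_mul, Complex.ofReal_div,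
    Complex.ofReal_pow, rho_eq Ψ t p, ← Complex.conj_mul', Fplus, Fx_eq Ψ t p, Fy_eq Ψ t p,
    Fz_eq Ψ t p, A00_eq Ψ t p, soc_eq Ψ t p, Lz_eq Ψ t p, map_add, map_mul, hX, hY, hZ,
    Complex.conj_I, hd, hd', hψ]
  simp only [Params.energyFamily, Params.interaction, Pi.add_apply, Pi.mul_apply, cst_apply]
  generalize dens (components Ψ) (spinX (components Ψ)) t p = a
  generalize dens (components Ψ) (spinY (components Ψ)) t p = b
  generalize dens (components Ψ) (spinZ (components Ψ)) t p = c
  generalize dens (components Ψ) (components Ψ) t p = d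
  simp [dens, lift, radiusSq, Fin.sum_univ_five, Params.V, hx, hy]
  linear_combination (-(P.c₁ / 2) * b ^ 2) * Complex.I_sq

/-- The integrand of `G` up to terms with purely imaginary integral. -/
def Params.gFamily (P : Params) (u : SpinorFamily) : Family :=
  cst ((-P.Ω : ℝ) : ℂ) * dens u (spinRadial u) +
    cst P.γ * dens u (spinX (spinX u) + spinY (spinY u) + lift angular (spinZ u))

end Bridge

lemma Nice.gFamily (P : Params) {u : SpinorFamily} (hu : NiceSpinor u) : Nice (P.gFamily u) :=
  ((Nice.dens hu fun l => ((hu.spinX l).coord_mul 0).add ((hu.spinY l).coord_mul 1)).cst_mul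
    _).add ((Nice.dens hu ((hu.spinX.spinX.add hu.spinY.spinY).add
      (linearOp_angular.nice hu.spinZ))).cst_mul _)

/-- The Casimir identity `f_x² + f_y² = 6 - f_z²` for spin 2. Subtracting `2ρ` from the resulting
density leaves the weights 3, 4, 3 in `G`. -/
lemma spinX_spinX_add_spinY_spinY (u : SpinorFamily) :
    spinX (spinX u) + spinY (spinY u) =
      ![cst 2 * u 0, cst 5 * u 1, cst 6 * u 2, cst 5 * u 3, cst 2 * u 4] := by
  have h6 := halfSqrt6_mul_self
  funext l t p
  fin_cases l <;> simp [spinX, spinY]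
  · linear_combination (-(u 0 t p - halfSqrt6 * u 2 t p)) * Complex.I_sq
  · linear_combination (-(u 1 t p + halfSqrt6 * (halfSqrt6 * u 1 t p - halfSqrt6 * u 3 t p))) *
      Complex.I_sq + 2 * u 1 t p * h6
  · linear_combination (halfSqrt6 * (u 0 t p - halfSqrt6 * u 2 t p) -
      halfSqrt6 * (halfSqrt6 * u 2 t p - u 4 t p)) * Complex.I_sq + 4 * u 2 t p * h6
  · linear_combination (halfSqrt6 * (halfSqrt6 * u 1 t p - halfSqrt6 * u 3 t p) - u 3 t p) *
      Complex.I_sq + 2 * u 3 t p * h6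
  · linear_combination (halfSqrt6 * u 2 t p - u 4 t p) * Complex.I_sq

/-- Expanding, `(iy - x)(F_x + iF_y) = -(xF_x + yF_y) + i(yF_x - xF_y)`. The last part is `i` times
the density of `spinMoment`, whose integral is real, so it drops out of the real part. -/
lemma gDensity_eq {P : Params} {Ψ : ℝ → Plane → Spinor} (hu : NiceSpinor (components Ψ))
    (t : ℝ≥0) : P.gDensity (Ψ t) = (P.gFamily (components Ψ) +
      cst (Complex.I * P.Ω) * dens (components Ψ) (spinMoment (components Ψ))) t := by
  funext p
  have h := fun l => (hu l).1
  have hψ : ∀ l, Ψ t p l = components Ψ l t p := fun _ => rfl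
  have e : (dens (components Ψ) (spinX (spinX (components Ψ)) + spinY (spinY (components Ψ)) +
      lift angular (spinZ (components Ψ)))) t p =
      ((2 * rho (Ψ t p) + 3 * ‖Ψ t p 1‖ ^ 2 + 4 * ‖Ψ t p 2‖ ^ 2 + 3 * ‖Ψ t p 3‖ ^ 2 : ℝ) : ℂ)
        + 2 * (star (Ψ t p 0) * Lz (comp (Ψ t) 0) p) + star (Ψ t p 1) * Lz (comp (Ψ t) 1) p
        - star (Ψ t p 3) * Lz (comp (Ψ t) 3) p - 2 * (star (Ψ t p 4) * Lz (comp (Ψ t) 4) p) := by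
    have h0 : ∀ a, pd a 0 = 0 := fun a => pd_cst 0 a
    simp only [Complex.ofReal_add, Complex.ofReal_mul, Complex.ofReal_pow, rho_eq Ψ t p,
      ← Complex.conj_mul', Lz_eq Ψ t p, hψ]
    rw [spinX_spinX_add_spinY_spinY]
    simp [dens, spinZ, lift, angular, Fin.sum_univ_five, h, h0]
    ring
  simp only [Params.gDensity, Fplus, Fx_eq Ψ t p, Fy_eq Ψ t p, ← e]
  simp [Params.gFamily, spinMoment, spinRadial, dens, Fin.sum_univ_five]
  ring_nf
  simp
  ring

lemma re_total_gDensity {P : Params} {Ψ : ℝ → Plane → Spinor} (hu : NiceSpinor (components Ψ))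
    (t : ℝ≥0) : (∫ p, P.gDensity (Ψ t) p).re = (total (P.gFamily (components Ψ)) t).re := by
  have h : ∫ p, P.gDensity (Ψ t) p = total (P.gFamily (components Ψ) +
      cst (Complex.I * P.Ω) * dens (components Ψ) (spinMoment (components Ψ))) t := by
    rw [gDensity_eq hu]
    rfl
  rw [h, total_add (Nice.gFamily P hu) ((Nice.dens hu hu.spinMoment).cst_mul _), total_cst_mul]
  simp [SymmOp.total_im linearOp_spinMoment symmOp_spinMoment hu t]

lemma total_eq_const {f : Family} (h : WeakDeriv f 0) (t : ℝ≥0) : total f t = total f 0 := by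
  have hd : ∀ s ∈ Set.Ici (0 : ℝ), HasDerivWithinAt (fun τ : ℝ => total f τ.toNNReal) 0
      (Set.Ici 0) s := by
    intro s hs
    have := h.integral Nice.zero s.toNNReal
    rw [Real.coe_toNNReal s hs] at this
    simpa [total] using this
  have := (convex_Ici (0 : ℝ)).norm_image_sub_le_of_norm_hasDerivWithin_le (C := 0) hd
    (by simp) (Set.self_mem_Ici) (show (t : ℝ) ∈ Set.Ici 0 from t.2)
  simpa [sub_eq_zero] using this

/-- The square of a coordinate as an operator. -/
def coordSq (a : Fin 2) (f : Family) : Family := coord a * (coord a * f)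

/-! ### Time dependence of the moments, the energy and the angular momentum -/

section Moments

variable {P : Params} {γr : ℝ} {Ψ : ℝ → Plane → Spinor}

lemma coordSq_dens_apply (Ψ : ℝ → Plane → Spinor) (a : Fin 2) (l : Fin 5) (t : ℝ≥0) (p : Plane) :
    (star (components Ψ l) * coordSq a (components Ψ l)) t p =
      ((p a ^ 2 * ‖Ψ t p l‖ ^ 2 : ℝ) : ℂ) := by
  have hψ : Ψ t p l = components Ψ l t p := rfl
  rw [hψ]
  push_cast
  rw [← Complex.conj_mul']
  simp [coordSq]
  ring

lemma nice_coordSq {f : Family} (hf : Nice f) (a : Fin 2) : Nice (coordSq a f) :=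
  (hf.coord_mul a).coord_mul a

lemma integrable_coord_sq_mul (hu : NiceSpinor (components Ψ)) (a : Fin 2) (l : Fin 5)
    (t : ℝ≥0) : Integrable (fun p : Plane => p a ^ 2 * ‖Ψ t p l‖ ^ 2) := by
  have h := (((hu l).star.mul (nice_coordSq (hu l) a)).integrable t).re
  refine h.congr (Eventually.of_forall fun p => ?_)
  simp only [coordSq_dens_apply]
  exact Complex.ofReal_re _

lemma delta_eq (hu : NiceSpinor (components Ψ)) (a : Fin 2) (t : ℝ≥0) :
    ((delta a (Ψ t) : ℝ) : ℂ) =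
      total (dens (components Ψ) (lift (coordSq a) (components Ψ))) t := by
  have h : ∀ l, Integrable ((star (components Ψ l) * coordSq a (components Ψ l)) t) :=
    fun l => ((hu l).star.mul (nice_coordSq (hu l) a)).integrable t
  have e : ∀ p, dens (components Ψ) (lift (coordSq a) (components Ψ)) t p =
      ∑ l, (star (components Ψ l) * coordSq a (components Ψ l)) t p := by
    intro p
    simp [dens, lift]
  rw [total]
  simp only [e]
  rw [integral_finsetSum _ fun l _ => h l]
  simp only [coordSq_dens_apply, delta, integral_complex_ofReal, Complex.ofReal_sum]

lemma deltaR_eq (hu : NiceSpinor (components Ψ)) (t : ℝ≥0) :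
    ((deltaR (Ψ t) : ℝ) : ℂ) = total (dens (components Ψ) (lift radiusSq (components Ψ))) t := by
  have e : dens (components Ψ) (lift radiusSq (components Ψ)) =
      dens (components Ψ) (lift (coordSq 0) (components Ψ)) +
        dens (components Ψ) (lift (coordSq 1) (components Ψ)) := by
    rw [← dens_add_right]
    rfl
  have h : ∀ a, Nice (dens (components Ψ) (lift (coordSq a) (components Ψ))) :=
    fun a => Nice.dens hu fun l => nice_coordSq (hu l) a
  rw [deltaR, Complex.ofReal_add, delta_eq hu, delta_eq hu, e, total_add (h 0) (h 1)]

lemma WeakDeriv.re {f g : Family} (h : WeakDeriv f g) (hg : Nice g) (t : ℝ≥0) :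
    HasDerivWithinAt (fun τ : ℝ => (total f τ.toNNReal).re) (total g t).re (Set.Ici 0) t :=
  Complex.reCLM.hasFDerivAt.comp_hasDerivWithinAt (t : ℝ) (h.integral hg t)

lemma exists_hasDerivWithinAt_delta (h : P.Evolves γr (components Ψ)) (a : Fin 2) (t : ℝ≥0) :
    ∃ d, HasDerivWithinAt (fun τ => delta a (Ψ τ)) d (Set.Ici 0) t := by
  have hd := derivRules_time.dens h.deriv fun l => ((h.deriv l).coord_mul a).coord_mul a
  have hw : WeakDeriv (dens (components Ψ) (lift (coordSq a) (components Ψ))) _ :=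
    ⟨_, hd, EqDiv.refl _⟩
  have e : ∀ t : ℝ≥0, delta a (Ψ t) =
      (total (dens (components Ψ) (lift (coordSq a) (components Ψ))) t).re := fun t => by
    rw [← delta_eq h.nice, Complex.ofReal_re]
  refine ⟨_, (hw.re hd.nice_deriv t).congr (fun τ hτ => ?_) ?_⟩
  · rw [← e, Real.coe_toNNReal τ hτ]
  · rw [Real.toNNReal_coe, ← e]

/-- The density whose integral is the time derivative of `δ_r`. -/
def Params.deltaRateFamily (P : Params) (u : SpinorFamily) : Family :=
  cst 2 * dens u (lift symmDilation u) + cst (2 * P.γ) * dens u (spinMoment u)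

lemma hasDerivWithinAt_deltaR (h : P.Evolves γr (components Ψ)) (t : ℝ≥0) :
    HasDerivWithinAt (fun τ => deltaR (Ψ τ)) (total (P.deltaRateFamily (components Ψ)) t).re
      (Set.Ici 0) t := by
  have hu := h.nice
  have e : ∀ t : ℝ≥0, deltaR (Ψ t) =
      (total (dens (components Ψ) (lift radiusSq (components Ψ))) t).re := fun t => by
    rw [← deltaR_eq h.nice, Complex.ofReal_re]
  refine (h.weakDeriv_radiusSq.re (((Nice.dens hu (linearOp_symmDilation.nice hu)).cst_mul _).add
    ((Nice.dens hu hu.spinMoment).cst_mul _)) t).congr (fun τ hτ => ?_) ?_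
  · rw [← e, Real.coe_toNNReal τ hτ]
  · rw [Real.toNNReal_coe, ← e]

lemma energy_eq (hx : P.γx = γr) (hy : P.γy = γr) (h : P.Evolves γr (components Ψ)) (t : ℝ≥0) :
    P.energy (Ψ t) =
      total (dens (components Ψ) (P.ham γr (components Ψ)) + P.interaction (components Ψ)) t := by
  have hu := h.nice
  rw [Params.energy, energyDensity_eq Ψ t hx hy]
  exact (eqDiv_energyFamily P γr hu).integral_eq
    ((Nice.dens hu ((linearOp_ham P γr).nice hu)).add (Nice.interaction hu P)) t

lemma energy_const (hx : P.γx = γr) (hy : P.γy = γr) (h : P.Evolves γr (components Ψ))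
    (t : ℝ≥0) : P.energy (Ψ t) = P.energy (Ψ 0) := by
  have h0 := energy_eq hx hy h 0
  rw [NNReal.coe_zero] at h0
  rw [energy_eq hx hy h, h0]
  exact total_eq_const h.weakDeriv_energy t

lemma angMom_eq (Ψ : ℝ → Plane → Spinor) (t : ℝ≥0) :
    angMom (Ψ t) = total (dens (components Ψ) (lift angular (components Ψ))) t := by
  rw [angMom, angMomDensity_eq]
  rfl

lemma angMom_const (hγ : P.γ = 0) (h : P.Evolves γr (components Ψ)) (t : ℝ≥0) :
    angMom (Ψ t) = angMom (Ψ 0) := by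
  have h0 := angMom_eq Ψ 0
  rw [NNReal.coe_zero] at h0
  rw [angMom_eq, h0]
  exact total_eq_const (h.weakDeriv_angular hγ) t

/-- The rates of `symmDilation` and `spinMoment` each supply `2γ⟨K⟩`. Completing to `4ℰ` turns the
trap coefficient `-2γr²` into `-4γr²` and creates `4Ω⟨L_z⟩`. -/
lemma hasDerivWithinAt_deltaRate (hx : P.γx = γr) (hy : P.γy = γr)
    (h : P.Evolves γr (components Ψ)) (t : ℝ≥0) :
    HasDerivWithinAt (fun τ : ℝ => (total (P.deltaRateFamily (components Ψ)) τ.toNNReal).re)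
      (-4 * γr ^ 2 * deltaR (Ψ t) + 4 * (P.energy (Ψ 0)).re + 4 * P.Ω * (angMom (Ψ t)).re
        + P.G (Ψ t)) (Set.Ici 0) t := by
  have hu := h.nice
  set u := components Ψ with hudef
  have hR := Nice.dens hu (linearOp_radiusSq.nice hu)
  have hA := Nice.dens hu (linearOp_angular.nice hu)
  have hE := (Nice.dens hu ((linearOp_ham P γr).nice hu)).add (Nice.interaction hu P)
  have hG := Nice.gFamily P hu
  have hw := (h.weakDeriv_symmDilation.cst_mul 2).add (h.weakDeriv_spinMoment.cst_mul (2 * P.γ))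
  set T : Family := cst ((-4 * γr ^ 2 : ℝ) : ℂ) * dens u (lift radiusSq u)
    + cst ((4 : ℝ) : ℂ) * (dens u (P.ham γr u) + P.interaction u)
    + cst ((4 * P.Ω : ℝ) : ℂ) * dens u (lift angular u)
    + cst ((2 * P.γ : ℝ) : ℂ) * P.gFamily u with hT
  have hTn : Nice T := (((hR.cst_mul _).add (hE.cst_mul _)).add (hA.cst_mul _)).add (hG.cst_mul _)
  have hwT : WeakDeriv (P.deltaRateFamily u) T := by
    refine hw.trans (EqDiv.of_eq ?_)
    simp only [hT, Params.ham, dens_add_right, dens_scale_right, Params.gFamily]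
    funext t p
    simp
    ring
  have hre := hwT.re hTn t
  convert hre using 1
  have hsum : total T t = ((-4 * γr ^ 2 : ℝ) : ℂ) * (deltaR (Ψ t) : ℂ)
      + ((4 : ℝ) : ℂ) * P.energy (Ψ 0) + ((4 * P.Ω : ℝ) : ℂ) * angMom (Ψ t)
      + ((2 * P.γ : ℝ) : ℂ) * total (P.gFamily u) t := by
    rw [hT, total_add (((hR.cst_mul _).add (hE.cst_mul _)).add (hA.cst_mul _)) (hG.cst_mul _),
      total_add ((hR.cst_mul _).add (hE.cst_mul _)) (hA.cst_mul _),
      total_add (hR.cst_mul _) (hE.cst_mul _), total_cst_mul, total_cst_mul, total_cst_mul,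
      total_cst_mul, ← energy_eq hx hy h, energy_const hx hy h, ← angMom_eq, ← deltaR_eq hu]
  rw [hsum, Complex.add_re, Complex.add_re, Complex.add_re, Complex.re_ofReal_mul,
    Complex.re_ofReal_mul, Complex.re_ofReal_mul, Complex.re_ofReal_mul, Complex.ofReal_re,
    Params.G, re_total_gDensity hu]

end Moments

/-- The forced harmonic oscillator on a half-line. -/
lemma harmonic_oscillator {y y' : ℝ → ℝ} {κ c : ℝ} (hκ : κ ≠ 0)
    (h : ∀ t, 0 ≤ t → HasDerivWithinAt y (y' t) (Set.Ici 0) t)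
    (h' : ∀ t, 0 ≤ t → HasDerivWithinAt y' (-κ ^ 2 * y t + c) (Set.Ici 0) t) {t : ℝ}
    (ht : 0 ≤ t) :
    y t = c / κ ^ 2 * (1 - Real.cos (κ * t)) + y 0 * Real.cos (κ * t)
      + y' 0 / κ * Real.sin (κ * t) := by
  have hconst : ∀ f : ℝ → ℝ, (∀ s ∈ Set.Ici (0 : ℝ), HasDerivWithinAt f 0 (Set.Ici 0) s) →
      f t = f 0 := by
    intro f hf
    have := (convex_Ici (0 : ℝ)).norm_image_sub_le_of_norm_hasDerivWithin_le (C := 0) hf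
      (by simp) (Set.self_mem_Ici) (show t ∈ Set.Ici 0 from ht)
    simpa [sub_eq_zero] using this
  have hcos : ∀ s, HasDerivAt (fun s => Real.cos (κ * s)) (-Real.sin (κ * s) * (κ * 1)) s :=
    fun s => ((hasDerivAt_id s).const_mul κ).cos
  have hsin : ∀ s, HasDerivAt (fun s => Real.sin (κ * s)) (Real.cos (κ * s) * (κ * 1)) s :=
    fun s => ((hasDerivAt_id s).const_mul κ).sin
  -- Rotating the phase vector `(y - c/κ², y'/κ)` back by the angle `κs` gives two conserved
  -- components, from which `y` is recovered.
  have h1 := hconst (fun s => (y s - c / κ ^ 2) * Real.cos (κ * s) - y' s / κ * Real.sin (κ * s))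
    (fun s hs => HasDerivWithinAt.congr_deriv
      ((((h s hs).sub_const (c / κ ^ 2)).mul (hcos s).hasDerivWithinAt).sub
        (((h' s hs).div_const κ).mul (hsin s).hasDerivWithinAt)) (by
      field_simp
      ring))
  have h2 := hconst (fun s => (y s - c / κ ^ 2) * Real.sin (κ * s) + y' s / κ * Real.cos (κ * s))
    (fun s hs => HasDerivWithinAt.congr_deriv
      ((((h s hs).sub_const (c / κ ^ 2)).mul (hsin s).hasDerivWithinAt).add
        (((h' s hs).div_const κ).mul (hcos s).hasDerivWithinAt)) (by
      field_simp
      ring))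
  simp only [mul_zero, Real.cos_zero, Real.sin_zero, mul_one, sub_zero, zero_add] at h1 h2
  linear_combination Real.cos (κ * t) * h1 + Real.sin (κ * t) * h2 -
    (y t - c / κ ^ 2) * Real.sin_sq_add_cos_sq (κ * t)

/-! ### Rotation by a right angle -/

/-- The rotation `(x, y) ↦ (-y, x)`. -/
def quarterTurn : Plane ≃ₗᵢ[ℝ] Plane :=
  LinearIsometry.toLinearIsometryEquiv
    { toFun := fun p => !₂[-p 1, p 0]
      map_add' := fun p q => by
        ext i
        fin_cases i <;> simp [add_comm]
      map_smul' := fun c p => by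
        ext i
        fin_cases i <;> simp
      norm_map' := fun p => by
        simp [EuclideanSpace.norm_eq, Fin.sum_univ_two, add_comm] } rfl

@[simp] lemma quarterTurn_apply_zero (p : Plane) : quarterTurn p 0 = -p 1 := rfl
@[simp] lemma quarterTurn_apply_one (p : Plane) : quarterTurn p 1 = p 0 := rfl

/-- Composition with the rotation by a right angle. -/
def turn (f : Family) : Family := fun t p => f t (quarterTurn p)

@[simp] lemma turn_apply (f : Family) (t : ℝ≥0) (p : Plane) :
    turn f t p = f t (quarterTurn p) := rfl

lemma SliceSmooth.turn {f : Family} (hf : SliceSmooth f) : SliceSmooth (turn f) :=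
  fun t => (hf t).comp quarterTurn.toContinuousLinearEquiv.contDiff

lemma pd_turn {f : Family} (hf : SliceSmooth f) (a : Fin 2) (t : ℝ≥0) (p : Plane) :
    pd a (turn f) t p = fderiv ℝ (f t) (quarterTurn p)
      (quarterTurn (EuclideanSpace.single a 1)) := by
  have h : HasFDerivAt (fun q => f t (quarterTurn q))
      ((fderiv ℝ (f t) (quarterTurn p)).comp
        (quarterTurn.toContinuousLinearEquiv : Plane →L[ℝ] Plane)) p :=
    (hf.differentiableAt t (quarterTurn p)).hasFDerivAt.comp p
      (quarterTurn.toContinuousLinearEquiv : Plane →L[ℝ] Plane).hasFDerivAt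
  change fderiv ℝ (fun q => f t (quarterTurn q)) p _ = _
  rw [h.fderiv]
  rfl

lemma pd_zero_turn {f : Family} (hf : SliceSmooth f) : pd 0 (turn f) = turn (pd 1 f) := by
  funext t p
  have e : quarterTurn (EuclideanSpace.single 0 1) = EuclideanSpace.single 1 1 := by
    ext i
    fin_cases i <;> simp
  rw [pd_turn hf, e]
  rfl

lemma pd_one_turn {f : Family} (hf : SliceSmooth f) : pd 1 (turn f) = -turn (pd 0 f) := by
  funext t p
  have e : quarterTurn (EuclideanSpace.single 1 1) = -EuclideanSpace.single 0 1 := by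
    ext i
    fin_cases i <;> simp
  rw [pd_turn hf, e, map_neg]
  rfl

lemma RapidDecay.turn {f : Family} (hf : RapidDecay f) : RapidDecay (turn f) := by
  intro T k
  obtain ⟨C, hC⟩ := hf T k
  refine ⟨C, fun t ht p => ?_⟩
  have := hC t ht (quarterTurn p)
  rwa [quarterTurn.norm_map] at this

lemma RapidDecayOrder.neg {n : ℕ} {f : Family} (hf : SliceSmooth f) (h : RapidDecayOrder n f) :
    RapidDecayOrder n (-f) := by
  have : -f = cst (-1) * f := by funext t p; simp
  rw [this]
  exact h.cst_mul hf _

lemma RapidDecayOrder.turn : ∀ {n : ℕ} {f : Family}, SliceSmooth f →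
    RapidDecayOrder n f → RapidDecayOrder n (turn f)
  | 0, _, _, h => RapidDecay.turn h
  | n + 1, f, hf, h => ⟨h.1.turn, Fin.forall_fin_two.2 ⟨by
      rw [pd_zero_turn hf]; exact (h.2 1).turn (hf.pd 1), by
      rw [pd_one_turn hf]; exact ((h.2 0).turn (hf.pd 0)).neg (hf.pd 0).turn⟩⟩

lemma Nice.turn {f : Family} (hf : Nice f) : Nice (turn f) :=
  ⟨hf.1.turn, fun n => (hf.2 n).turn hf.1⟩

lemma TimeDeriv.turn {f f' : Family} (h : TimeDeriv f f') : TimeDeriv (turn f) (turn f') :=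
  ⟨h.1.turn, h.2.turn, fun t p => h.3 t (quarterTurn p)⟩

lemma kinetic_turn {f : Family} (hf : SliceSmooth f) : kinetic (turn f) = turn (kinetic f) := by
  have h1 := (hf.pd 1).turn
  have h0 := (hf.pd 0).turn
  simp only [kinetic, pd_zero_turn hf, pd_one_turn hf, pd_neg, pd_zero_turn (hf.pd 1),
    pd_one_turn (hf.pd 0)]
  funext t p
  simp
  ring

lemma radiusSq_turn (f : Family) : radiusSq (turn f) = turn (radiusSq f) := by
  funext t p
  simp [radiusSq]
  ring

lemma angular_turn {f : Family} (hf : SliceSmooth f) : angular (turn f) = turn (angular f) := by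
  simp only [angular, pd_zero_turn hf, pd_one_turn hf]
  funext t p
  simp
  ring

/-- Without the spin-orbit term the Hamiltonian commutes with a rotation of space alone, so a
rotated solution is again a solution. -/
lemma ham_turn {P : Params} (hγ : P.γ = 0) (γr : ℝ) {u : SpinorFamily} (hu : NiceSpinor u) :
    P.ham γr (lift turn u) = lift turn (P.ham γr u) := by
  funext l
  simp only [Params.ham, Pi.add_apply (ι := Fin 5), lift, scale, kinetic_turn (hu l).1,
    radiusSq_turn, angular_turn (hu l).1, hγ]
  funext t p
  simp

/-- The nonlinearity as a map of spinors. -/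
def Params.nonlinMap (P : Params) (v : Spinor) : Spinor :=
  fun l => P.nonlin (fun l _ _ => v l) l 0 0

/-- The nonlinearity is local in time and space; this makes it compatible with rotations and reduces
its Lipschitz estimate to one on `ℂ⁵`. -/
lemma nonlin_apply (P : Params) (u : SpinorFamily) (l : Fin 5) (t : ℝ≥0) (p : Plane) :
    P.nonlin u l t p = P.nonlinMap (fun l => u l t p) l := by
  fin_cases l <;>
    simp [Params.nonlinMap, Params.nonlin, dens, spinX, spinY, spinZ, singlet, pairing, scale,
      Fin.sum_univ_five]

lemma contDiff_nonlinMap (P : Params) : ContDiff ℝ 1 P.nonlinMap := by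
  obtain ⟨c, hc⟩ : ∃ c : ℂ →L[ℝ] ℂ, ∀ z, (starRingEnd ℂ) z = c z :=
    ⟨Complex.conjCLE, fun _ => rfl⟩
  rw [contDiff_pi]
  intro l
  fin_cases l <;>
    simp [Params.nonlinMap, Params.nonlin, dens, spinX, spinY, spinZ, singlet, pairing, scale,
      Fin.sum_univ_five] <;>
    simp only [hc] <;> fun_prop

lemma exists_lipschitz_nonlinMap (P : Params) (R : ℝ) : ∃ K : ℝ, 0 ≤ K ∧ ∀ v w : Spinor,
    ‖v‖ ≤ R → ‖w‖ ≤ R → ‖P.nonlinMap v - P.nonlinMap w‖ ≤ K * ‖v - w‖ := by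
  obtain ⟨K, hK⟩ := ((contDiff_nonlinMap P).locallyLipschitz.locallyLipschitzOn
    (s := Metric.closedBall 0 R)).exists_lipschitzOnWith_of_compact (isCompact_closedBall _ _)
  exact ⟨K, K.2, fun v w hv hw => hK.norm_sub_le (by simpa using hv) (by simpa using hw)⟩

/-! ### Uniqueness and persistence of the symmetry -/

section Symmetric

variable {P : Params} {γr : ℝ} {u : SpinorFamily}

lemma dens_self_eq (w : SpinorFamily) (t : ℝ≥0) (p : Plane) :
    dens w w t p = ((∑ l, ‖w l t p‖ ^ 2 : ℝ) : ℂ) := by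
  simp [dens, Complex.conj_mul']

lemma exists_norm_bound (hu : NiceSpinor u) (T : ℝ≥0) :
    ∃ R : ℝ, ∀ t ≤ T, ∀ p, ‖(fun l => u l t p : Spinor)‖ ≤ R := by
  have h := fun l => (hu l).2 0 T 0
  choose C hC using h
  refine ⟨∑ l, |C l|, fun t ht p => ?_⟩
  rw [pi_norm_le_iff_of_nonneg (Finset.sum_nonneg fun l _ => abs_nonneg _)]
  intro l
  have h1 := hC l t ht p
  rw [pow_zero, one_mul] at h1
  exact (h1.trans (le_abs_self _)).trans
    (Finset.single_le_sum (f := fun l => |C l|) (fun l _ => abs_nonneg _) (Finset.mem_univ l))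

/-- Uniqueness: an initially symmetric solution remains symmetric. -/
lemma total_dens_sub_turn_eq_zero (h : P.Evolves γr u) (hγ : P.γ = 0)
    (h0 : ∀ l p, u l 0 (quarterTurn p) = u l 0 p) (t : ℝ≥0) :
    total (dens (u - lift turn u) (u - lift turn u)) t = 0 := by
  have hu := h.nice
  have hut : NiceSpinor (lift turn u) := fun l => (hu l).turn
  set w : SpinorFamily := u - lift turn u with hw
  have hwn : NiceSpinor w := hu.sub hut
  set n : SpinorFamily := P.nonlin u - lift turn (P.nonlin u) with hn
  have hnn : NiceSpinor n := (hu.nonlin P).sub fun l => (hu.nonlin P l).turn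
  have hsubop : ∀ u v : SpinorFamily, NiceSpinor u → NiceSpinor v →
      P.ham γr (u - v) = P.ham γr u - P.ham γr v := by
    intro u v hu hv
    have e : u - v = u + scale (-1) v := by funext l t p; simp [scale]; ring
    rw [e, (linearOp_ham P γr).add hu (hv.scale _), (linearOp_ham P γr).scale _ hv]
    funext l t p
    simp [scale]
    ring
  have hwd : ∀ l, TimeDeriv (w l) (scale (-Complex.I) (P.ham γr w + n) l) := by
    intro l
    have := (h.deriv l).sub (h.deriv l).turn
    convert this using 1
    · rfl
    rw [hw, hsubop u _ hu hut, ham_turn hγ γr hu]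
    funext t p
    simp [Params.velocity, scale, hn, lift]
    ring
  -- By symmetry the Hamiltonian drops out of the evolution of `|w|²` up to a divergence; only the
  -- difference `n` of the nonlinearities remains.
  have hderiv : WeakDeriv (dens w w) (cst Complex.I * (dens n w - dens w n)) := by
    refine ⟨_, derivRules_time.dens hwd hwd, ?_⟩
    have e1 := (symmOp_ham P γr w w hwn hwn).cst_mul Complex.I
    have e2 := e1.add (EqDiv.refl (cst Complex.I * (dens n w - dens w n) -
      cst Complex.I * dens w (P.ham γr w)))
    have hI : star Complex.I = -Complex.I := Complex.conj_I
    convert e2 using 1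
    · simp only [dens_scale_left, dens_scale_right, dens_add_left, dens_add_right, star_neg, hI,
        neg_neg]
      funext t p
      simp
      ring
    · ring
  have hgn : Nice (cst Complex.I * (dens n w - dens w n)) :=
    ((Nice.dens hnn hwn).sub (Nice.dens hwn hnn)).cst_mul _
  obtain ⟨R, hR⟩ := exists_norm_bound hu t
  obtain ⟨K, hK0, hK⟩ := exists_lipschitz_nonlinMap P R
  -- The factor 10 counts two pairings of five components each.
  have hbound : ∀ s ≤ t, ‖total (cst Complex.I * (dens n w - dens w n)) s‖ ≤
      (10 * K) * ‖total (dens w w) s‖ := by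
    intro s hs
    have hpt : ∀ p, ‖(cst Complex.I * (dens n w - dens w n)) s p‖ ≤
        (10 * K) * ∑ l, ‖w l s p‖ ^ 2 := by
      intro p
      have hdiff : ‖(fun l => n l s p : Spinor)‖ ≤ K * ‖(fun l => w l s p : Spinor)‖ := by
        have e1 : (fun l => n l s p : Spinor) = P.nonlinMap (fun l => u l s p) -
            P.nonlinMap (fun l => u l s (quarterTurn p)) := by
          funext l
          rw [Pi.sub_apply, ← nonlin_apply, ← nonlin_apply]
          rfl
        rw [e1]
        exact hK _ _ (hR s hs p) (hR s hs (quarterTurn p))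
      set m := ‖(fun l => w l s p : Spinor)‖ with hm
      -- `m` is a supremum norm, attained by one of the components.
      have hm2 : m ^ 2 ≤ ∑ l, ‖w l s p‖ ^ 2 := by
        obtain ⟨l, hl⟩ : ∃ l, m = ‖w l s p‖ := by
          obtain ⟨l, -, hl⟩ := Finset.exists_mem_eq_sup Finset.univ Finset.univ_nonempty
            (fun l => ‖w l s p‖₊)
          refine ⟨l, ?_⟩
          rw [hm, Pi.norm_def, hl]
          rfl
        rw [hl]
        exact Finset.single_le_sum (f := fun l => ‖w l s p‖ ^ 2) (fun _ _ => by positivity)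
          (Finset.mem_univ l)
      have hwl : ∀ l, ‖w l s p‖ ≤ m := fun l => norm_le_pi_norm (fun l => w l s p : Spinor) l
      have hnl : ∀ l, ‖n l s p‖ ≤ K * m := fun l =>
        (norm_le_pi_norm (fun l => n l s p : Spinor) l).trans hdiff
      have hdens : ∀ a b : SpinorFamily, (∀ l, ‖a l s p‖ * ‖b l s p‖ ≤ K * m ^ 2) →
          ‖dens a b s p‖ ≤ 5 * (K * m ^ 2) := by
        intro a b hab
        have e : dens a b s p = ∑ l, (starRingEnd ℂ) (a l s p) * b l s p := by simp [dens]
        rw [e]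
        refine (norm_sum_le _ _).trans
          ((Finset.sum_le_card_nsmul _ _ (K * m ^ 2) fun l _ => ?_).trans
          (by simp))
        rw [norm_mul, RCLike.norm_conj]
        exact hab l
      have hm0 : 0 ≤ m := norm_nonneg _
      have h1 := hdens n w fun l => by
        calc ‖n l s p‖ * ‖w l s p‖ ≤ (K * m) * m :=
              mul_le_mul (hnl l) (hwl l) (norm_nonneg _) (by positivity)
          _ = K * m ^ 2 := by ring
      have h2 := hdens w n fun l => by
        calc ‖w l s p‖ * ‖n l s p‖ ≤ m * (K * m) :=
              mul_le_mul (hwl l) (hnl l) (norm_nonneg _) hm0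
          _ = K * m ^ 2 := by ring
      calc ‖(cst Complex.I * (dens n w - dens w n)) s p‖ = ‖dens n w s p - dens w n s p‖ := by
            simp
        _ ≤ 5 * (K * m ^ 2) + 5 * (K * m ^ 2) := (norm_sub_le _ _).trans (add_le_add h1 h2)
        _ = (10 * K) * m ^ 2 := by ring
        _ ≤ _ := by gcongr
    have hint : Integrable fun p => ∑ l, ‖w l s p‖ ^ 2 := by
      have := ((Nice.dens hwn hwn).integrable s).re
      refine this.congr (Eventually.of_forall fun p => ?_)
      simp only [dens_self_eq]
      exact Complex.ofReal_re _
    have htot : ‖total (dens w w) s‖ = ∫ p, ∑ l, ‖w l s p‖ ^ 2 := by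
      have : total (dens w w) s = ((∫ p, ∑ l, ‖w l s p‖ ^ 2 : ℝ) : ℂ) := by
        rw [total, ← integral_complex_ofReal]
        simp only [dens_self_eq]
      rw [this, Complex.norm_real, Real.norm_of_nonneg]
      exact integral_nonneg fun p => Finset.sum_nonneg fun l _ => by positivity
    rw [htot, ← integral_const_mul]
    exact (norm_integral_le_integral_norm _).trans
      (integral_mono (hgn.integrable s).norm (hint.const_mul _) hpt)
  have hd : ∀ s : ℝ, 0 ≤ s → HasDerivWithinAt (fun τ : ℝ => total (dens w w) τ.toNNReal)
      (total (cst Complex.I * (dens n w - dens w n)) s.toNNReal) (Set.Ici 0) s := by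
    intro s hs
    have := hderiv.integral hgn s.toNNReal
    rwa [Real.coe_toNNReal s hs] at this
  -- Grönwall's inequality with initial value zero.
  have hzero := eq_zero_of_abs_deriv_le_mul_abs_self_of_eq_zero_right (a := 0) (b := t)
    (f := fun τ : ℝ => total (dens w w) τ.toNNReal) (K := 10 * K)
    (fun s hs => ((hd s hs.1).continuousWithinAt).mono Set.Icc_subset_Ici_self)
    (fun s hs => (hd s hs.1).mono (Set.Ici_subset_Ici.2 hs.1)) (by
      have : ∀ p, dens w w 0 p = 0 := fun p => by simp [dens, hw, lift, h0]
      simp [total, this])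
    (fun s hs => hbound _ (by rw [Real.toNNReal_le_iff_le_coe]; exact hs.2.le)) t
    ⟨t.2, le_rfl⟩
  simpa using hzero

end Symmetric

/-- The vanishing `L²` distance makes the densities invariant almost everywhere under the quarter
turn, which preserves measure and carries `y²` to `x²`. -/
lemma delta_zero_eq_delta_one {P : Params} {γr : ℝ} {Ψ : ℝ → Plane → Spinor}
    (h : P.Evolves γr (components Ψ)) (hγ : P.γ = 0) (hr : IsRadial (Ψ 0)) (t : ℝ≥0) :
    delta 0 (Ψ t) = delta 1 (Ψ t) := by
  set u := components Ψ with hu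
  set w : SpinorFamily := u - lift turn u with hw
  have h0 : ∀ l p, u l 0 (quarterTurn p) = u l 0 p := fun l p => by
    have := hr (quarterTurn p) p (quarterTurn.norm_map p)
    simpa [hu, components] using congrFun this l
  have hz := total_dens_sub_turn_eq_zero h hγ h0 t
  have hwn : NiceSpinor w := fun l => (h.nice l).sub (h.nice l).turn
  have hint : Integrable fun p => ∑ l, ‖w l t p‖ ^ 2 :=
    ((Nice.dens hwn hwn).integrable t).re.congr (Eventually.of_forall fun p => by
      simp only [dens_self_eq]
      exact Complex.ofReal_re _)
  have hzero : ∫ p, ∑ l, ‖w l t p‖ ^ 2 = 0 := by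
    rw [total] at hz
    simp only [dens_self_eq] at hz
    rw [integral_complex_ofReal] at hz
    exact_mod_cast hz
  have hae := (integral_eq_zero_iff_of_nonneg
    (fun p => Finset.sum_nonneg fun l _ => by positivity) hint).1 hzero
  have hsym : ∀ᵐ p : Plane, ∀ l, Ψ t (quarterTurn p) l = Ψ t p l := by
    filter_upwards [hae] with p hp l
    have := (Finset.sum_eq_zero_iff_of_nonneg fun l _ => by positivity).1 hp l (Finset.mem_univ l)
    have hwl : w l t p = 0 := by simpa using this
    exact (sub_eq_zero.1 hwl).symm
  refine Finset.sum_congr rfl fun l _ => ?_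
  calc ∫ p : Plane, p 0 ^ 2 * ‖Ψ t p l‖ ^ 2
      = ∫ p : Plane, (quarterTurn p) 1 ^ 2 * ‖Ψ t (quarterTurn p) l‖ ^ 2 :=
        integral_congr_ae (by
          filter_upwards [hsym] with p hp
          rw [hp l, quarterTurn_apply_one])
    _ = ∫ p : Plane, p 1 ^ 2 * ‖Ψ t p l‖ ^ 2 :=
        quarterTurn.measurePreserving.integral_comp
          quarterTurn.toHomeomorph.measurableEmbedding
          (fun q : Plane => q 1 ^ 2 * ‖Ψ t q l‖ ^ 2)

/-! ### Harmonic motion without spin-orbit coupling -/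

section Breathing

variable {P : Params} {γr : ℝ} {Ψ : ℝ → Plane → Spinor}

lemma derivWithin_deltaR (h : P.Evolves γr (components Ψ)) {t : ℝ} (ht : 0 ≤ t) :
    derivWithin (fun τ => deltaR (Ψ τ)) (Set.Ici 0) t
      = (total (P.deltaRateFamily (components Ψ)) t.toNNReal).re := by
  lift t to ℝ≥0 using ht
  simpa using (hasDerivWithinAt_deltaR h t).derivWithin (uniqueDiffOn_Ici 0 _ t.2)

lemma derivWithin_delta_add (h : P.Evolves γr (components Ψ)) :
    derivWithin (fun τ => delta 0 (Ψ τ)) (Set.Ici 0) 0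
      + derivWithin (fun τ => delta 1 (Ψ τ)) (Set.Ici 0) 0
      = derivWithin (fun τ => deltaR (Ψ τ)) (Set.Ici 0) 0 := by
  obtain ⟨d₀, h₀⟩ := exists_hasDerivWithinAt_delta h 0 0
  obtain ⟨d₁, h₁⟩ := exists_hasDerivWithinAt_delta h 1 0
  have hU : UniqueDiffWithinAt ℝ (Set.Ici (0 : ℝ)) 0 := uniqueDiffOn_Ici 0 _ Set.self_mem_Ici
  rw [NNReal.coe_zero] at h₀ h₁
  rw [h₀.derivWithin hU, h₁.derivWithin hU]
  exact ((h₀.add h₁).derivWithin hU).symm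

lemma G_eq_zero (hγ : P.γ = 0) (Φ : Plane → Spinor) : P.G Φ = 0 := by
  simp [Params.G, hγ]

lemma deltaR_closed_form (hx : P.γx = γr) (hy : P.γy = γr) (h : P.Evolves γr (components Ψ))
    (hγ : P.γ = 0) (hγr : 0 < γr) {t : ℝ} (ht : 0 ≤ t) :
    deltaR (Ψ t) =
      ((P.energy (Ψ 0)).re + P.Ω * (angMom (Ψ 0)).re) / γr ^ 2 * (1 - Real.cos (2 * γr * t))
      + (delta 0 (Ψ 0) + delta 1 (Ψ 0)) * Real.cos (2 * γr * t)
      + (derivWithin (fun τ => delta 0 (Ψ τ)) (Set.Ici 0) 0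
          + derivWithin (fun τ => delta 1 (Ψ τ)) (Set.Ici 0) 0) / (2 * γr)
        * Real.sin (2 * γr * t) := by
  have key := harmonic_oscillator (y := fun τ => deltaR (Ψ τ))
    (y' := fun τ => (total (P.deltaRateFamily (components Ψ)) τ.toNNReal).re)
    (κ := 2 * γr) (c := 4 * ((P.energy (Ψ 0)).re + P.Ω * (angMom (Ψ 0)).re)) (by positivity)
    (fun s hs => by
      lift s to ℝ≥0 using hs
      simpa using hasDerivWithinAt_deltaR h s)
    (fun s hs => by
      lift s to ℝ≥0 using hs
      convert hasDerivWithinAt_deltaRate hx hy h s using 1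
      rw [angMom_const hγ h s, G_eq_zero hγ]
      ring) ht
  rw [derivWithin_delta_add h, derivWithin_deltaR h le_rfl]
  refine key.trans ?_
  rw [show 4 * ((P.energy (Ψ 0)).re + P.Ω * (angMom (Ψ 0)).re) / (2 * γr) ^ 2
    = ((P.energy (Ψ 0)).re + P.Ω * (angMom (Ψ 0)).re) / γr ^ 2 by field_simp; ring]
  rfl

lemma deltaR_periodic (hx : P.γx = γr) (hy : P.γy = γr) (h : P.Evolves γr (components Ψ))
    (hγ : P.γ = 0) (hγr : 0 < γr) {t : ℝ} (ht : 0 ≤ t) :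
    deltaR (Ψ (t + 2 * Real.pi / (2 * γr))) = deltaR (Ψ t) := by
  have e : 2 * γr * (t + 2 * Real.pi / (2 * γr)) = 2 * γr * t + 2 * Real.pi := by
    field_simp
  rw [deltaR_closed_form hx hy h hγ hγr ht, deltaR_closed_form hx hy h hγ hγr
    (by have := Real.pi_pos; positivity), e, Real.cos_add_two_pi, Real.sin_add_two_pi]

lemma delta_eq_half_deltaR (h : P.Evolves γr (components Ψ)) (hγ : P.γ = 0)
    (hr : IsRadial (Ψ 0)) {t : ℝ} (ht : 0 ≤ t) (a : Fin 2) :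
    delta a (Ψ t) = deltaR (Ψ t) / 2 := by
  lift t to ℝ≥0 using ht
  have := delta_zero_eq_delta_one h hγ hr t
  rw [deltaR]
  fin_cases a
  · change delta 0 (Ψ t) = _
    linarith
  · change delta 1 (Ψ t) = _
    linarith

end Breathing

end

end SpinTwoBEC

open SpinTwoBEC in
theorem lemma2 (P : Params) (γr : ℝ) (hx : P.γx = γr) (hy : P.γy = γr)
    (Ψ : ℝ → Plane → Spinor) (hΨ : P.IsSolution Ψ) :
    -- all quantities are well defined, the energy and `⟨L_z⟩` are real
    (∀ t : ℝ, 0 ≤ t →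
      (∀ (a : Fin 2) (l : Fin 5), Integrable (fun p : Plane => p a ^ 2 * ‖Ψ t p l‖ ^ 2)) ∧
      Integrable (P.energyDensity (Ψ t)) ∧ Integrable (angMomDensity (Ψ t)) ∧
      Integrable (P.gDensity (Ψ t)) ∧
      (P.energy (Ψ t)).im = 0 ∧ (angMom (Ψ t)).im = 0) ∧
    -- the differential equation
    (∀ a : Fin 2, DifferentiableOn ℝ (fun t => delta a (Ψ t)) (Set.Ici 0)) ∧
    (∀ t : ℝ, 0 ≤ t →
      HasDerivWithinAt (derivWithin (fun τ => deltaR (Ψ τ)) (Set.Ici 0))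
        (-4 * γr ^ 2 * deltaR (Ψ t) + 4 * (P.energy (Ψ 0)).re + 4 * P.Ω * (angMom (Ψ t)).re
          + P.G (Ψ t)) (Set.Ici 0) t) ∧
    -- without spin-orbit coupling
    (P.γ = 0 → 0 < γr →
      (∀ t : ℝ, 0 ≤ t →
        deltaR (Ψ t) =
          ((P.energy (Ψ 0)).re + P.Ω * (angMom (Ψ 0)).re) / γr ^ 2 * (1 - Real.cos (2 * γr * t))
          + (delta 0 (Ψ 0) + delta 1 (Ψ 0)) * Real.cos (2 * γr * t)
          + (derivWithin (fun τ => delta 0 (Ψ τ)) (Set.Ici 0) 0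
              + derivWithin (fun τ => delta 1 (Ψ τ)) (Set.Ici 0) 0) / (2 * γr)
            * Real.sin (2 * γr * t)) ∧
      (∀ t : ℝ, 0 ≤ t → deltaR (Ψ (t + 2 * Real.pi / (2 * γr))) = deltaR (Ψ t)) ∧
      (IsRadial (Ψ 0) →
        (∀ t : ℝ, 0 ≤ t → ∀ a : Fin 2, delta a (Ψ t) = deltaR (Ψ t) / 2) ∧
        (∀ t : ℝ, 0 ≤ t → ∀ a : Fin 2,
          sigma a (Ψ (t + 2 * Real.pi / (2 * γr))) = sigma a (Ψ t)))) := by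
  have hu := hΨ.niceSpinor
  have hev := hΨ.evolves hx hy
  refine ⟨fun t ht => ?_, fun a t ht => ?_, fun t ht => ?_, fun hγ hγr =>
    ⟨fun t ht => deltaR_closed_form hx hy hev hγ hγr ht,
      fun t ht => deltaR_periodic hx hy hev hγ hγr ht,
      fun hr => ⟨fun t ht a => delta_eq_half_deltaR hev hγ hr ht a, fun t ht a => ?_⟩⟩⟩
  · lift t to NNReal using ht
    refine ⟨fun a l => integrable_coord_sq_mul hu a l t, ?_, ?_, ?_, ?_, ?_⟩
    · rw [energyDensity_eq Ψ t hx hy]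
      exact (Nice.energyFamily P γr hu).integrable t
    · rw [angMomDensity_eq Ψ t]
      exact (Nice.dens hu fun l => (hu l).angular).integrable t
    · rw [gDensity_eq hu t]
      exact ((Nice.gFamily P hu).add ((Nice.dens hu hu.spinMoment).cst_mul _)).integrable t
    · rw [energy_eq hx hy hev t, total_add
        (Nice.dens hu ((linearOp_ham P γr).nice hu)) (Nice.interaction hu P), Complex.add_im,
        SymmOp.total_im (linearOp_ham P γr) (symmOp_ham P γr) hu,
        total_im_of_star_eq (star_interaction P _), add_zero]
    · rw [angMom_eq]
      exact SymmOp.total_im linearOp_angular symmOp_angular hu t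
  · lift t to NNReal using ht
    obtain ⟨d, hd⟩ := exists_hasDerivWithinAt_delta hev a t
    exact hd.differentiableWithinAt
  · have hd := fun s (hs : s ∈ Set.Ici (0 : ℝ)) => derivWithin_deltaR hev hs
    -- On `[0, ∞)` the one-sided derivative of `δ_r` is the integral of `deltaRateFamily`, whose own
    -- derivative is known.
    refine HasDerivWithinAt.congr ?_ hd (hd t ht)
    lift t to NNReal using ht
    exact hasDerivWithinAt_deltaRate hx hy hev t
  · have ht' : 0 ≤ t + 2 * Real.pi / (2 * γr) := by
      have := Real.pi_pos
      positivity
    rw [sigma, sigma, delta_eq_half_deltaR hev hγ hr ht, delta_eq_half_deltaR hev hγ hr ht',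
      deltaR_periodic hx hy hev hγ hγr ht]
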